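/- Conventions. Tableaux are drawn in English convention and $T_c$ denotes the set of numbers in column $c$ of $T$. For finite $S,T\subset\mathbb Z_{>0}$, the set $T\triangleleft S$ is obtained as follows: go through the elements $s\in S$ from largest to smallest; each $s$ picks the largest element of $T$ that is less than $s$ and has not yet been picked, if there is one; $T\triangleleft S$ is the set of picked elements. Iterated expressions $A_1\triangleleft A_2\triangleleft\cdots\triangleleft A_k$ are evaluated from right to left. An increasing tableau of normal (resp. skew) shape is a filling of a Young diagram (resp. skew Young diagram) with positive integers, strictly increasing along rows and down columns. For $m\ge 0$ let $\mathrm{sInc}_{m<\bullet}$ be the set of fillings of skew Young diagrams with positive integers and symbols $\bullet$ that are strictly increasing along rows and down columns for the order $1<\cdots<m<\bullet<m+1<\cdots$. For $m\ge1$, the reverse K-jeu-de-taquin move $\mathrm{sInc}_{m<\bullet}\to\mathrm{sInc}_{m-1<\bullet}$ simultaneously replaces each $\bullet$ that is adjacent (along an edge) to an $m$ by $m$, and each $m$ that is adjacent to a $\bullet$ by $\bullet$. To anti-rectify an increasing tableau $T$, repeat the following round until the shape is anti-normal (right-justified and bottom-justified): choose $m$ at least as large as all entries, add cells containing $\bullet$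 at vacant positions so that an element of $\mathrm{sInc}_{m<\bullet}$ results, apply the reverse K-jeu-de-taquin moves for $m,m-1,\dots,1$, and delete all $\bullet$. The left key $K_-(P)$ of an increasing tableau $P$ of normal shape with $r$ rows and $C$ columns is defined column by column: for $1\le j\le C$, keep only the first $j$ columns of $P$ and anti-rectify inside the rectangle with $r$ rows and $j$ columns, in each round placing a single $\bullet$ at the leftmost available position in the rectangle; the numbers in the leftmost column of the result form column $j$ of $K_-(P)$. Theorem. Let $P$ be an increasing tableau of normal shape with $C$ columns. (1) If $P^{\searrow}$ is the result of anti-rectifying $P$, with any choice of the positions of the $\bullet$'s, and the rightmost column of $P^{\searrow}$ is column $C$, then $P^{\searrow}_1 = P_1\triangleleft P_2\triangleleft\cdots\triangleleft P_C$. (2) For every $1\le i\le C$, the process that defines column $i$ of $K_-(P)$ can be carried out to an anti-normal shape, and column $i$ of $K_-(P)$ consists of $P_1\triangleleft P_2\triangleleft\cdots\triangleleft P_i$. -/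

import Mathlib

noncomputable section

namespace IncTab

/-- The content of a position `(row, column)`: no cell there, a cell containing the symbol `•`,
or a cell containing the number `k`. -/
inductive Cell : Type
  | empty : Cell
  | bullet : Cell
  | num (k : ℕ) : Cell

/-- A filling of a set of cells in the quadrant, in English convention with rows and columns
numbered from `0` (as for `YoungDiagram`): `T (r, c)` is the content of the position in row `r`
and column `c`. -/
abbrev Filling : Type := ℕ × ℕ → Cell

/-- The underlying set of cells. -/
def shape (T : Filling) : Set (ℕ × ℕ) := {p | T p ≠ Cell.empty}

/-- `s` is the skew Young diagram of `lam / mu` for some `mu ⊆ lam`. -/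
def IsSkewShape (s : Set (ℕ × ℕ)) : Prop :=
  ∃ lam mu : YoungDiagram, mu ≤ lam ∧ s = {p | p ∈ lam ∧ p ∉ mu}

/-- The strict order `1 < ⋯ < m < • < m + 1 < ⋯` on entries. -/
def Precedes (m : ℕ) : Cell → Cell → Prop
  | Cell.num a, Cell.num b => a < b
  | Cell.num a, Cell.bullet => a ≤ m
  | Cell.bullet, Cell.num b => m < b
  | _, _ => False

/-- Membership in `sInc_{m < •}`: a dotted skew tableau, filled by positive integers and `•`, whose
rows and columns are strictly increasing for `1 < ⋯ < m < • < m + 1 < ⋯`. -/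
structure IsDottedIncreasing (m : ℕ) (T : Filling) : Prop where
  skew : IsSkewShape (shape T)
  pos : ∀ p k, T p = Cell.num k → 0 < k
  row : ∀ r c c', c < c' → (r, c) ∈ shape T → (r, c') ∈ shape T → Precedes m (T (r, c)) (T (r, c'))
  col : ∀ r r' c, r < r' → (r, c) ∈ shape T → (r', c) ∈ shape T → Precedes m (T (r, c)) (T (r', c))

/-- `P` is an increasing tableau of normal shape `lam`: it fills the cells of `lam` with positive
integers, strictly increasing along rows and down columns. -/
structure IsIncreasingTableau (lam : YoungDiagram) (P : Filling) : Prop where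
  shape_eq : shape P = {p | p ∈ lam}
  no_bullet : ∀ p, P p ≠ Cell.bullet
  pos : ∀ p k, P p = Cell.num k → 0 < k
  row : ∀ r c c' a b, c < c' → P (r, c) = Cell.num a → P (r, c') = Cell.num b → a < b
  col : ∀ r r' c a b, r < r' → P (r, c) = Cell.num a → P (r', c) = Cell.num b → a < b

/-- All numbers in `T` are at most `m`. -/
def EntriesLE (m : ℕ) (T : Filling) : Prop := ∀ p k, T p = Cell.num k → k ≤ m

/-- Two positions that share an edge. -/
def Adjacent (p q : ℕ × ℕ) : Prop :=
  (p.1 = q.1 ∧ (p.2 = q.2 + 1 ∨ q.2 = p.2 + 1)) ∨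
  (p.2 = q.2 ∧ (p.1 = q.1 + 1 ∨ q.1 = p.1 + 1))

open Classical in
/-- Reverse K-jeu-de-taquin at `m`: simultaneously, each `•` adjacent to an `m` becomes `m`, and each
`m` adjacent to a `•` becomes `•`. -/
def revKjdt (m : ℕ) (T : Filling) : Filling := fun p =>
  match T p with
  | Cell.empty => Cell.empty
  | Cell.bullet => if ∃ q, Adjacent p q ∧ T q = Cell.num m then Cell.num m else Cell.bullet
  | Cell.num k =>
      if k = m ∧ ∃ q, Adjacent p q ∧ T q = Cell.bullet then Cell.bullet else Cell.num k

/-- Apply `revKjdt` at `m`, then at `m - 1`, and so on down to `1`. -/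
def revKjdtAll : ℕ → Filling → Filling
  | 0, T => T
  | m + 1, T => revKjdtAll m (revKjdt (m + 1) T)

/-- Put a `•` at every position in `B`. -/
def addBullets (T : Filling) (B : Finset (ℕ × ℕ)) : Filling := fun p =>
  if p ∈ B then Cell.bullet else T p

/-- Delete all cells that contain `•`. -/
def removeBullets (T : Filling) : Filling := fun p =>
  match T p with
  | Cell.empty => Cell.empty
  | Cell.bullet => Cell.empty
  | Cell.num k => Cell.num k

/-- The `•`s may be added to `T` at the (vacant) positions in `B`, giving an element of
`sInc_{m < •}`. -/
def CanAdd (m : ℕ) (T : Filling) (B : Finset (ℕ × ℕ)) : Prop :=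
  (∀ p ∈ B, T p = Cell.empty) ∧ IsDottedIncreasing m (addBullets T B)

/-- The result of adding `•`s at `B`, applying `revKjdt` at `m, …, 1`, and removing all `•`s. -/
def slide (m : ℕ) (T : Filling) (B : Finset (ℕ × ℕ)) : Filling :=
  removeBullets (revKjdtAll m (addBullets T B))

/-- One round of anti-rectification, with an arbitrary admissible choice of positions. -/
def AntiRectStep (T T' : Filling) : Prop :=
  ∃ (m : ℕ) (B : Finset (ℕ × ℕ)), EntriesLE m T ∧ CanAdd m T B ∧ T' = slide m T B

/-- The shape is right-justified and bottom-justified (at the lower right corner of some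
`R` by `C` rectangle). -/
def IsAntiNormal (T : Filling) : Prop :=
  ∃ R C : ℕ, ∀ p ∈ shape T, p.1 < R ∧ p.2 < C ∧
    ∀ q : ℕ × ℕ, p ≤ q → q.1 < R → q.2 < C → q ∈ shape T

/-- `Q` is a result of anti-rectifying `P`, for some choices of where to put the `•`s. -/
def IsAntiRectification (P Q : Filling) : Prop :=
  Relation.ReflTransGen AntiRectStep P Q ∧ IsAntiNormal Q

/-- The rightmost column of `T` is the `C`-th one (counting from `1`); `C = 0` if `T` has no
cells. -/
def HasRightmostColumn (T : Filling) (C : ℕ) : Prop :=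
  IsLeast {n : ℕ | ∀ p ∈ shape T, p.2 < n} C

/-- One round of anti-rectification inside the rectangle with `R` rows and `C` columns, with one `•`
placed at the leftmost available position. -/
def LeftmostStep (R C : ℕ) (T T' : Filling) : Prop :=
  ∃ (m : ℕ) (p : ℕ × ℕ), EntriesLE m T ∧ p.1 < R ∧ p.2 < C ∧ CanAdd m T {p} ∧
    (∀ q : ℕ × ℕ, q.1 < R → q.2 < C → CanAdd m T {q} → p.2 ≤ q.2) ∧ T' = slide m T {p}

/-- Keep only the first `j` columns. -/
def firstCols (j : ℕ) (T : Filling) : Filling := fun p => if p.2 < j then T p else Cell.empty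

open Classical in
/-- The set of numbers in column `c` of `T`, columns being numbered from `0` (for a filling of a
finite set of cells; the value `∅` for an infinite column is never used). -/
def col (T : Filling) (c : ℕ) : Finset ℕ :=
  if h : {k : ℕ | ∃ r, T (r, c) = Cell.num k}.Finite then h.toFinset else ∅

/-- `K` is the `j`-th column (counting from `1`) of the left key of the tableau `P` with `R` rows: the
set of numbers in the leftmost column after the first `j` columns of `P` have been anti-rectified
inside the rectangle with `R` rows and `j` columns, always with one `•` at the leftmost
available position. -/
def IsLeftKeyColumn (R : ℕ) (P : Filling) (j : ℕ) (K : Finset ℕ) : Prop :=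
  ∃ Q : Filling, Relation.ReflTransGen (LeftmostStep R j) (firstCols j P) Q ∧ IsAntiNormal Q ∧
    K = col Q 0

/-- The entries `s` of the list in turn pick the largest element of `T` that is less than `s` and has
not been picked; the result is the set of picked elements. -/
def pick : Finset ℕ → List ℕ → Finset ℕ
  | _, [] => ∅
  | T, s :: L =>
      if h : (T.filter (fun t => t < s)).Nonempty then
        insert ((T.filter (fun t => t < s)).max' h)
          (pick (T.erase ((T.filter (fun t => t < s)).max' h)) L)
      else pick T L

/-- `T ◁ S`: the elements of `S` pick from `T`, from the largest to the smallest. -/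
def tri (T S : Finset ℕ) : Finset ℕ := pick T (S.sort (fun a b => b ≤ a))

/-- `A₁ ◁ A₂ ◁ ⋯ ◁ Aₙ`, evaluated from right to left. -/
def triProd : List (Finset ℕ) → Finset ℕ
  | [] => ∅
  | [A] => A
  | A :: B :: L => tri A (triProd (B :: L))

/-- `P₁ ◁ P₂ ◁ ⋯ ◁ Pⱼ`, where `P₁, …, Pⱼ` are the first `j` columns of `P`. -/
def colProd (P : Filling) (j : ℕ) : Finset ℕ := triProd ((List.range j).map (col P))

end IncTab

end

/-! Read `T ◁ S` as a queue. Values are scanned downwards, elements of `S` are arrivals, elements of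
`T` are services, and `T ◁ S` is the set of services that find a customer. The queue length obeys a
one-step recursion (`IsQueue`), so identities between products become comparisons of queue lengths.

The theorem rests on an invariant: each reverse K-jeu-de-taquin move preserves the product of the
columns (`IsDottedIncreasing.prodFrom_revKjdt`). A move at `m` changes a column only by inserting or
removing `m`. If `m` enters column `c + 1`, then column `c` has an `m` directly left of a `•`. The
extra service at `m` lets a customer pass earlier from one queue to the next, but comparing the two
columns above that row shows that the services of column `c` below the value `m` are used anyway
(`tri_tri_insert`). If `m` leaves column `c`, comparing the two columns below its row shows that the
service at `m` was idle, so it may be dropped (`tri_erase`). At the right edge, `m` cannot leave the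
last column, because the numbers of the result stay in the first `C` columns.

In an anti-normal filling every column is fully used by its right neighbour
(`IsAntiNormal.tri_col_succ`), so the product collapses to the first column. This gives (1).

For (2), a run inside the rectangle is an anti-rectification of the first `i` columns, so (1)
determines its value. It remains to see that some run reaches an anti-normal shape. Columns are
extended to the bottom of the rectangle from left to right, and the danger is that one becomes
empty. But the product is nonempty for a normal shape, is invariant, and is contained in the first
column, so that column survives. The later columns that reach the bottom have tops at least as high,
so they survive too (`IsPartialAntiRect.exists_step`). -/

namespace IncTab

/-! ### The operation `◁` as a queue

Scan the values downwards; elements of `S` are arrivals and elements of `T` are services, a service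
at `v` taking place before an arrival at `v`. Then `T ◁ S` is the set of services in use. -/

/-- `q v` is the number of elements of `S` above `v` that are still waiting when the elements of `T`
above `v` have been offered. -/
structure IsQueue (T S : Finset ℕ) (q : ℕ → ℕ) : Prop where
  bdd : ∃ N, ∀ v, N ≤ v → q v = 0
  step : ∀ v, q v = (q (v + 1) - if v + 1 ∈ T then 1 else 0) + if v + 1 ∈ S then 1 else 0

theorem downward_induction {p : ℕ → Prop} (N : ℕ) (base : ∀ v, N ≤ v → p v)
    (step : ∀ v, p (v + 1) → p v) (v : ℕ) : p v := by
  rcases le_total N v with h | h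
  · exact base v h
  · exact Nat.decreasingInduction (fun k _ hk => step k hk) (base N le_rfl) h

theorem IsQueue.unique {T S : Finset ℕ} {q q' : ℕ → ℕ} (h : IsQueue T S q) (h' : IsQueue T S q') :
    q = q' := by
  obtain ⟨N, hN⟩ := h.bdd
  obtain ⟨N', hN'⟩ := h'.bdd
  funext v
  refine downward_induction (p := fun v => q v = q' v) (max N N') ?_ ?_ v
  · intro v hv
    rw [hN v (le_trans (le_max_left _ _) hv), hN' v (le_trans (le_max_right _ _) hv)]
  · intro v hv
    rw [h.step v, h'.step v, hv]

theorem IsQueue.eq_zero_of_forall_le {T S : Finset ℕ} {q : ℕ → ℕ} (h : IsQueue T S q) {n : ℕ}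
    (hS : ∀ s ∈ S, s ≤ n) (v : ℕ) (hv : n ≤ v) : q v = 0 := by
  obtain ⟨N, hN⟩ := h.bdd
  refine downward_induction (p := fun v => n ≤ v → q v = 0) N (fun v hv _ => hN v hv) ?_ v hv
  intro v ih hv
  have : v + 1 ∉ S := fun hs => by have := hS _ hs; omega
  rw [h.step v, ih (by omega), if_neg this]
  omega

/-- The largest customer `s` waits exactly on the interval from `s - 1` down to the service `t` it
picks, or down to `0` if it picks none. No other service lies strictly between `t` and `s`, and the
later customers are all below `s`, so this interval is simply added to the queue of the remaining
list. -/
theorem exists_isQueue_pick (L : List ℕ) : ∀ T : Finset ℕ, L.Pairwise (fun a b => b < a) →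
    ∃ q, IsQueue T L.toFinset q ∧ ∀ v, v ∈ pick T L ↔ v ∈ T ∧ 0 < q v := by
  induction L with
  | nil =>
    intro T _
    exact ⟨fun _ => 0, ⟨⟨0, by simp⟩, by simp⟩, by simp [pick]⟩
  | cons s L ih =>
    intro T hL
    rw [List.pairwise_cons] at hL
    obtain ⟨hs, hL⟩ := hL
    by_cases h : (T.filter (fun t => t < s)).Nonempty
    · set t := (T.filter (fun t => t < s)).max' h with ht
      have htm := Finset.max'_mem _ h
      rw [← ht, Finset.mem_filter] at htm
      have hmax : ∀ x ∈ T, x < s → x ≤ t := fun x hx hxs =>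
        Finset.le_max' _ _ (Finset.mem_filter.2 ⟨hx, hxs⟩)
      obtain ⟨q, hq, hm⟩ := ih (T.erase t) hL
      have hz : ∀ v, s ≤ v + 1 → q v = 0 := fun v hv =>
        hq.eq_zero_of_forall_le (n := s - 1)
          (fun x hx => by have := hs x (List.mem_toFinset.1 hx); omega) v (by omega)
      refine ⟨fun v => q v + if t ≤ v ∧ v < s then 1 else 0, ⟨⟨s, fun v hv => ?_⟩, fun v => ?_⟩, ?_⟩
      · rw [hz v (by omega), if_neg (by omega)]
      · have h1 := hq.step v
        have h2 : v + 1 ∈ T → v + 1 < s → v + 1 ≤ t := hmax _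
        have h3 := hz v
        have h4 := hz (v + 1)
        have h5 : v + 1 ∈ L → v + 1 < s := hs _
        have h6 := htm.1
        have h7 := htm.2
        simp only [Finset.mem_erase, List.toFinset_cons, Finset.mem_insert, List.mem_toFinset]
          at h1 ⊢
        by_cases e1 : v + 1 = t
        · have e2 : v + 1 ∈ T := e1 ▸ h6
          simp only [e1, ne_eq, not_true_eq_false, false_and, if_false] at h1
          rw [if_neg (by omega), if_pos e2, if_pos (by omega), h1, e1,
            if_congr (show (t = s ∨ t ∈ L) ↔ t ∈ L from
              ⟨fun h => h.resolve_left (by omega), Or.inr⟩) rfl rfl]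
          omega
        · grind
      · intro v
        have h3 := hz v
        have h2 : v ∈ T → v < s → v ≤ t := hmax _
        rw [pick, dif_pos h, ← ht, Finset.mem_insert, hm, Finset.mem_erase]
        have h6 := htm.1
        have h7 := htm.2
        grind
    · have hmax : ∀ x ∈ T, s ≤ x := fun x hx => by
        by_contra hlt
        exact h ⟨x, Finset.mem_filter.2 ⟨hx, by omega⟩⟩
      obtain ⟨q, hq, hm⟩ := ih T hL
      have hz : ∀ v, s ≤ v + 1 → q v = 0 := fun v hv =>
        hq.eq_zero_of_forall_le (n := s - 1)
          (fun x hx => by have := hs x (List.mem_toFinset.1 hx); omega) v (by omega)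
      refine ⟨fun v => q v + if v < s then 1 else 0, ⟨⟨s, fun v hv => ?_⟩, fun v => ?_⟩, ?_⟩
      · rw [hz v (by omega), if_neg (by omega)]
      · have h1 := hq.step v
        have h2 : v + 1 ∈ T → s ≤ v + 1 := hmax _
        have h3 := hz v
        have h4 := hz (v + 1)
        have h5 : v + 1 ∈ L → v + 1 < s := hs _
        simp only [List.toFinset_cons, Finset.mem_insert, List.mem_toFinset] at h1 ⊢
        grind
      · intro v
        have h2 : v ∈ T → s ≤ v := hmax _
        rw [pick, dif_neg h, hm]
        grind

theorem exists_isQueue (T S : Finset ℕ) : ∃ q, IsQueue T S q ∧ ∀ v, v ∈ tri T S ↔ v ∈ T ∧ 0 < q v := by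
  have := exists_isQueue_pick (S.sort (fun a b => b ≤ a)) T ?_
  · simpa [tri] using this
  · exact ((S.pairwise_sort (fun a b => b ≤ a)).and (S.sort_nodup _)).imp
      fun h => lt_of_le_of_ne h.1 h.2.symm

theorem IsQueue.mem_tri {T S : Finset ℕ} {q : ℕ → ℕ} (h : IsQueue T S q) (v : ℕ) :
    v ∈ tri T S ↔ v ∈ T ∧ 0 < q v := by
  obtain ⟨q', h', hm⟩ := exists_isQueue T S
  rw [h.unique h', hm]

theorem tri_subset (T S : Finset ℕ) : tri T S ⊆ T := by
  obtain ⟨q, -, hm⟩ := exists_isQueue T S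
  exact fun v hv => ((hm v).1 hv).1

theorem pick_nonempty (L : List ℕ) : ∀ T : Finset ℕ, (∃ s ∈ L, ∃ t ∈ T, t < s) →
    (pick T L).Nonempty := by
  induction L with
  | nil => simp
  | cons s L ih =>
    rintro T ⟨x, hx, t, ht, hlt⟩
    rw [pick]
    split_ifs with h
    · exact Finset.insert_nonempty _ _
    · refine ih T ⟨x, ?_, t, ht, hlt⟩
      rcases List.mem_cons.1 hx with rfl | hx
      · exact absurd ⟨t, Finset.mem_filter.2 ⟨ht, hlt⟩⟩ h
      · exact hx

theorem tri_nonempty {T S : Finset ℕ} {s t : ℕ} (hs : s ∈ S) (ht : t ∈ T) (h : t < s) :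
    (tri T S).Nonempty :=
  pick_nonempty _ _ ⟨s, (Finset.mem_sort _).2 hs, t, ht, h⟩

/-! ### Counting conditions that control a queue. -/

theorem card_filter_Ioc_succ (A : Finset ℕ) (m v : ℕ) (h : m ≤ v) :
    (A.filter (fun x => m < x ∧ x ≤ v + 1)).card =
      (A.filter (fun x => m < x ∧ x ≤ v)).card + if v + 1 ∈ A then 1 else 0 := by
  split_ifs with hv
  · rw [← Finset.card_insert_of_notMem (a := v + 1) (by simp)]
    congr 1
    ext x
    simp only [Finset.mem_filter, Finset.mem_insert]
    grind
  · congr 1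
    ext x
    simp only [Finset.mem_filter]
    grind

theorem card_filter_Ioo_succ (A : Finset ℕ) (m v : ℕ) (h : v + 1 < m) :
    (A.filter (fun x => v < x ∧ x < m)).card =
      (A.filter (fun x => v + 1 < x ∧ x < m)).card + if v + 1 ∈ A then 1 else 0 := by
  split_ifs with hv
  · rw [← Finset.card_insert_of_notMem (a := v + 1) (by simp)]
    congr 1
    ext x
    simp only [Finset.mem_filter, Finset.mem_insert]
    grind
  · congr 1
    ext x
    simp only [Finset.mem_filter]
    grind

/-- If enough services lie above `m`, at most `e` customers wait at `m`. -/
theorem IsQueue.le_of_card_le {A U : Finset ℕ} {q : ℕ → ℕ} (h : IsQueue A U q) (m e : ℕ)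
    (hc : ∀ x, (U.filter (fun y => m < y ∧ y ≤ x)).card ≤
      (A.filter (fun y => m < y ∧ y < x)).card + e) : q m ≤ e := by
  obtain ⟨N, hN⟩ := h.bdd
  -- A service that finds a customer preserves this bound. If a service idles at `v + 1`, the queue
  -- restarts from zero and `hc (v + 1)` gives the bound afresh.
  have key := downward_induction (p := fun v => m ≤ v →
    q v + (U.filter (fun y => m < y ∧ y ≤ v)).card ≤
      (A.filter (fun y => m < y ∧ y ≤ v)).card + e) N ?_ ?_ m le_rfl
  · have h0 : ∀ B : Finset ℕ, B.filter (fun y => m < y ∧ y ≤ m) = ∅ := fun B =>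
      Finset.filter_false_of_mem fun x _ => by omega
    simpa [h0] using key
  · intro v hv hm
    rw [hN v hv, zero_add]
    refine (hc v).trans (Nat.add_le_add_right (Finset.card_le_card ?_) _)
    intro x
    simp only [Finset.mem_filter]
    exact fun hx => ⟨hx.1, hx.2.1, hx.2.2.le⟩
  · intro v ih hm
    have h1 := ih (by omega)
    have h2 := card_filter_Ioc_succ A m v hm
    have h3 := card_filter_Ioc_succ U m v hm
    have h4 := hc (v + 1)
    have h5 : A.filter (fun y => m < y ∧ y < v + 1) = A.filter (fun y => m < y ∧ y ≤ v) := by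
      simp only [Nat.lt_succ_iff]
    rw [h5] at h4
    have h6 := h.step v
    split_ifs at * <;> omega

/-- A service that finds the queue empty may be dropped. -/
theorem tri_erase {A U : Finset ℕ} (m : ℕ)
    (hc : ∀ x, (U.filter (fun y => m < y ∧ y ≤ x)).card ≤
      (A.filter (fun y => m < y ∧ y < x)).card) : tri (A.erase m) U = tri A U := by
  obtain ⟨q, hq, hm⟩ := exists_isQueue A U
  have h0 : q m ≤ 0 := hq.le_of_card_le m 0 hc
  have hq' : IsQueue (A.erase m) U q := by
    refine ⟨hq.bdd, fun v => ?_⟩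
    have := hq.step v
    simp only [Finset.mem_erase]
    grind
  ext v
  rw [hq'.mem_tri, hm, Finset.mem_erase]
  grind

/-- If arrivals dominate the services, then every service is used. -/
theorem tri_eq_left {A U : Finset ℕ}
    (hc : ∀ a ∈ A, (A.filter (fun y => a ≤ y)).card ≤ (U.filter (fun y => a < y)).card) :
    tri A U = A := by
  obtain ⟨q, hq, hm⟩ := exists_isQueue A U
  have hs : ∀ (B : Finset ℕ) v, (B.filter (fun y => v ≤ y)).card =
      (B.filter (fun y => v < y)).card + if v ∈ B then 1 else 0 := by
    intro B v
    split_ifs with hv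
    · rw [← Finset.card_insert_of_notMem (a := v) (by simp)]
      congr 1
      ext x
      simp only [Finset.mem_filter, Finset.mem_insert]
      grind
    · congr 1
      ext x
      simp only [Finset.mem_filter]
      grind
  -- Every arrival above `v` is either still waiting or has used a service above `v`.
  have key : ∀ v, (U.filter (fun y => v < y)).card ≤ q v + (A.filter (fun y => v < y)).card := by
    obtain ⟨N, hN⟩ : ∃ N, ∀ u ∈ U, u ≤ N := ⟨U.sup id, fun u hu => Finset.le_sup (f := id) hu⟩
    refine downward_induction N ?_ ?_
    · intro v hv
      rw [Finset.filter_false_of_mem (s := U) (by intro x hx; have := hN x hx; omega)]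
      simp
    · intro v ih
      have h1 := hs A (v + 1)
      have h2 := hs U (v + 1)
      have h3 := hq.step v
      simp only [Nat.succ_le_iff] at h1 h2
      split_ifs at * <;> omega
  refine Finset.Subset.antisymm (tri_subset _ _) fun a ha => (hm a).2 ⟨ha, ?_⟩
  have h1 := key a
  have h2 := hc a ha
  have h3 := hs A a
  rw [if_pos ha] at h3
  omega

/-- Adding a service at `m` to the first of two queues in series does not change the final
departures, under conditions that hold when both queues are columns of a tableau. -/
theorem tri_tri_insert {A B S : Finset ℕ} {m : ℕ} (hm : 0 < m) (hA : m ∈ A) (hB : m ∉ B)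
    (hc : ∀ x, (B.filter (fun y => m < y ∧ y ≤ x)).card ≤
      (A.filter (fun y => m < y ∧ y < x)).card + 1)
    (hd : ∀ a ∈ A, a < m → (A.filter (fun y => a ≤ y ∧ y < m)).card ≤
      (B.filter (fun y => a < y ∧ y < m)).card) :
    tri A (tri (insert m B) S) = tri A (tri B S) := by
  obtain ⟨q₁, hq₁, hm₁⟩ := exists_isQueue B S
  obtain ⟨p₁, hp₁, hn₁⟩ := exists_isQueue (insert m B) S
  obtain ⟨q₂, hq₂, hm₂⟩ := exists_isQueue A (tri B S)
  obtain ⟨p₂, hp₂, hn₂⟩ := exists_isQueue A (tri (insert m B) S)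
  have hz : q₂ m ≤ 1 := hq₂.le_of_card_le m 1 fun x =>
    (Finset.card_le_card (Finset.filter_subset_filter _ (tri_subset B S))).trans (hc x)
  obtain ⟨N₁, hN₁⟩ := hq₁.bdd
  obtain ⟨N₂, hN₂⟩ := hp₁.bdd
  obtain ⟨N₃, hN₃⟩ := hq₂.bdd
  obtain ⟨N₄, hN₄⟩ := hp₂.bdd
  have hd' : ∀ v, v < m → v ∈ A → (A.filter (fun y => v < y ∧ y < m)).card + 1 ≤
      (B.filter (fun y => v < y ∧ y < m)).card := by
    intro v hv hvA
    rw [← Finset.card_insert_of_notMem (a := v) (by simp)]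
    refine le_trans (Finset.card_le_card ?_) (hd v hvA hv)
    intro x
    simp only [Finset.mem_filter, Finset.mem_insert]
    grind
  -- The systems agree down to `m`. If the extra service is used, one customer has moved on to the
  -- second queue, until a service of `B` is used only in the original system and restores equality.
  -- Meanwhile `q₁` is positive, so every service of `B` below `m` feeds the second queue. This
  -- gives the last inequality, and with `hd'` it gives `0 < q₂ v` at each `v ∈ A`, so the services
  -- of `A` are used in both systems.
  have key : ∀ v, (m ≤ v → q₁ v = p₁ v ∧ q₂ v = p₂ v) ∧
      (v < m → (q₁ v = p₁ v ∧ q₂ v = p₂ v) ∨ (q₁ v = p₁ v + 1 ∧ p₂ v = q₂ v + 1 ∧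
        (B.filter (fun y => v < y ∧ y < m)).card ≤
          q₂ v + (A.filter (fun y => v < y ∧ y < m)).card)) := by
    refine downward_induction (N₁ + N₂ + N₃ + N₄ + m) ?_ ?_
    · intro v hv
      rw [hN₁ v (by omega), hN₂ v (by omega), hN₃ v (by omega), hN₄ v (by omega)]
      simp
    · intro v ih
      have s1 := hq₁.step v
      have s2 := hp₁.step v
      have s3 := hq₂.step v
      have s4 := hp₂.step v
      simp only [hm₁, hn₁, Finset.mem_insert] at s1 s2 s3 s4
      rcases lt_trichotomy (v + 1) m with h | h | h
      · have c1 := card_filter_Ioo_succ A m v h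
        have c2 := card_filter_Ioo_succ B m v h
        have c3 := hd' (v + 1) h
        have ih := ih.2 h
        have hne : v + 1 ≠ m := by omega
        simp only [hne, false_or] at s2 s4
        refine ⟨fun hv => by omega, fun _ => ?_⟩
        rcases ih with ⟨e1, e2⟩ | ⟨e1, e2, e3⟩
        · left
          rw [← e1] at s2 s4
          rw [← e2] at s4
          exact ⟨s1.trans s2.symm, s3.trans s4.symm⟩
        · have hpos : 0 < q₁ (v + 1) := by omega
          simp only [hpos, and_true] at s3
          by_cases a1 : v + 1 ∈ A <;> by_cases a2 : v + 1 ∈ B <;>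
            by_cases a3 : 0 < p₁ (v + 1) <;>
            simp only [a1, a2, a3, if_true, if_false, and_true, and_false, true_imp_iff] at s1 s2 s3 s4 c1 c2 c3 <;>
            omega
      · have ih := ih.1 h.ge
        refine ⟨fun hv => by omega, fun _ => ?_⟩
        have f0 : ∀ X : Finset ℕ, X.filter (fun y => v < y ∧ y < m) = ∅ := fun X =>
          Finset.filter_false_of_mem fun x _ => by omega
        rw [f0, f0]
        subst h
        simp only [hA, hB, if_true, if_false, true_or, true_and, false_and] at s1 s2 s3 s4
        simp only [Finset.card_empty]
        split_ifs at * <;> omega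
      · have ih := ih.1 h.le
        have hne : v + 1 ≠ m := by omega
        simp only [hne, false_or] at s2 s4
        rw [← ih.1] at s2 s4
        rw [← ih.2] at s4
        refine ⟨fun _ => ⟨s1.trans s2.symm, s3.trans s4.symm⟩, fun hv => by omega⟩
  ext v
  rw [hn₂, hm₂]
  have k := key v
  have d := hd' v
  constructor
  · rintro ⟨hvA, hv⟩
    refine ⟨hvA, ?_⟩
    rcases le_or_gt m v with h | h
    · have := k.1 h; omega
    · have := k.2 h
      have := d h hvA
      omega
  · rintro ⟨hvA, hv⟩
    refine ⟨hvA, ?_⟩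
    rcases le_or_gt m v with h | h
    · have := k.1 h; omega
    · have := k.2 h
      omega

/-! ### Iterated products -/

/-- `X a ◁ X (a + 1) ◁ ⋯ ◁ X (a + n - 1) ◁ S`. -/
def prodFrom (X : ℕ → Finset ℕ) (S : Finset ℕ) : ℕ → ℕ → Finset ℕ
  | _, 0 => S
  | a, n + 1 => tri (X a) (prodFrom X S (a + 1) n)

theorem prodFrom_subset (X : ℕ → Finset ℕ) (S : Finset ℕ) (a n : ℕ) (hn : 0 < n) :
    prodFrom X S a n ⊆ X a := by
  obtain ⟨n, rfl⟩ := Nat.exists_eq_add_of_lt hn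
  rw [zero_add, prodFrom]
  exact tri_subset _ _

/-- Enlarging columns, where each enlarged column is invisible after its left neighbour. -/
theorem prodFrom_enlarge {X D : ℕ → Finset ℕ} (S : Finset ℕ)
    (h : ∀ c, D (c + 1) ≠ X (c + 1) →
      D c = X c ∧ ∀ U, tri (X c) (tri (D (c + 1)) U) = tri (X c) (tri (X (c + 1)) U)) :
    ∀ n a, D a = X a → prodFrom D S a n = prodFrom X S a n := by
  intro n
  induction n using Nat.strong_induction_on with
  | _ n ih =>
    intro a ha
    rcases n with _ | n
    · rfl
    rw [prodFrom, prodFrom, ha]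
    by_cases h1 : D (a + 1) = X (a + 1)
    · rw [ih n (by omega) _ h1]
    · rcases n with _ | n
      · rfl
      -- Two neighbouring columns are never both enlarged, so the induction can jump over the
      -- enlarged one.
      have h2 : D (a + 1 + 1) = X (a + 1 + 1) := by
        by_contra h2
        exact h1 (h _ h2).1
      rw [prodFrom, prodFrom, (h a h1).2, ih n (by omega) _ h2]

/-- Shrinking columns, where the elements removed are invisible to the right neighbour. -/
theorem prodFrom_shrink {D Y : ℕ → Finset ℕ} (S : Finset ℕ) {C : ℕ}
    (h : ∀ c, c + 1 < C → ∀ U ⊆ D (c + 1), tri (D c) U = tri (Y c) U)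
    (hl : ∀ c, c + 1 = C → D c = Y c) :
    ∀ n a, a + n = C → prodFrom D S a n = prodFrom Y S a n := by
  intro n
  induction n with
  | zero => intros; rfl
  | succ n ih =>
    intro a ha
    rw [prodFrom, prodFrom, ← ih (a + 1) (by omega)]
    rcases n with _ | n
    · rw [hl a ha]
    · exact h a (by omega) _ (prodFrom_subset _ _ _ _ (by omega))

/-- The interval supplies `N` customers above everything in `A`, enough for all of `A`. As a neutral
last factor it lets the product of the columns be written with a fixed tail `S`. -/
theorem tri_Ico_eq_left {A : Finset ℕ} {N : ℕ} (hA : ∀ a ∈ A, a < N) :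
    tri A (Finset.Ico N (2 * N)) = A := by
  refine tri_eq_left fun a ha => ?_
  have h1 : (Finset.Ico N (2 * N)).filter (fun y => a < y) = Finset.Ico N (2 * N) := by
    refine Finset.filter_true_of_mem fun x hx => ?_
    have := hA a ha
    rw [Finset.mem_Ico] at hx
    omega
  rw [h1, Nat.card_Ico]
  calc (A.filter (fun y => a ≤ y)).card ≤ (Finset.range N).card :=
        Finset.card_le_card fun x hx => Finset.mem_range.2 (hA x (Finset.mem_filter.1 hx).1)
    _ = 2 * N - N := by rw [Finset.card_range]; omega

theorem triProd_eq_prodFrom (X : ℕ → Finset ℕ) (N : ℕ) (n : ℕ) : ∀ a,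
    (∀ x ∈ X (a + n), x < N) →
    triProd ((List.range' a (n + 1)).map X) = prodFrom X (Finset.Ico N (2 * N)) a (n + 1) := by
  induction n with
  | zero =>
    intro a h
    exact (tri_Ico_eq_left h).symm
  | succ n ih =>
    intro a h
    have h1 := ih (a + 1) (by rwa [show a + 1 + n = a + (n + 1) by omega])
    rw [prodFrom, ← h1, List.range'_succ, List.range'_succ]
    rfl

theorem colProd_eq_prodFrom (P : Filling) {C N : ℕ} (hC : 0 < C) (h : ∀ x ∈ col P (C - 1), x < N) :
    colProd P C = prodFrom (col P) (Finset.Ico N (2 * N)) 0 C := by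
  obtain ⟨n, rfl⟩ : ∃ n, C = n + 1 := ⟨C - 1, by omega⟩
  rw [colProd, List.range_eq_range', triProd_eq_prodFrom]
  simpa using h

/-! ### Fillings -/

theorem IsSkewShape.finite {s : Set (ℕ × ℕ)} (h : IsSkewShape s) : s.Finite := by
  obtain ⟨lam, mu, -, rfl⟩ := h
  exact lam.cells.finite_toSet.subset fun p hp => hp.1

theorem IsSkewShape.mem_of_le_of_le {s : Set (ℕ × ℕ)} (h : IsSkewShape s) {p x q : ℕ × ℕ} (hp : p ∈ s)
    (hq : q ∈ s) (hpx : p ≤ x) (hxq : x ≤ q) : x ∈ s := by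
  obtain ⟨lam, mu, -, rfl⟩ := h
  exact ⟨lam.isLowerSet hxq hq.1, fun hx => hp.2 (mu.isLowerSet hpx hx)⟩

theorem mem_shape_of_num {T : Filling} {p : ℕ × ℕ} {k : ℕ} (h : T p = Cell.num k) : p ∈ shape T := by
  simp [shape, h]

theorem mem_shape_of_bullet {T : Filling} {p : ℕ × ℕ} (h : T p = Cell.bullet) : p ∈ shape T := by
  simp [shape, h]

theorem bullet_or_num {T : Filling} {p : ℕ × ℕ} (h : p ∈ shape T) :
    T p = Cell.bullet ∨ ∃ k, T p = Cell.num k := by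
  cases hp : T p with
  | empty => exact absurd hp h
  | bullet => exact Or.inl rfl
  | num k => exact Or.inr ⟨k, rfl⟩

theorem mem_col {T : Filling} (hT : (shape T).Finite) {c k : ℕ} :
    k ∈ col T c ↔ ∃ r, T (r, c) = Cell.num k := by
  have hf : {k : ℕ | ∃ r, T (r, c) = Cell.num k}.Finite := by
    refine (hT.image fun p => match T p with | Cell.num k => k | _ => 0).subset ?_
    rintro k ⟨r, hr⟩
    exact ⟨(r, c), mem_shape_of_num hr, by simp [hr]⟩
  rw [col, dif_pos hf]
  simp

theorem col_congr {T T' : Filling} {c c' : ℕ}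
    (h : ∀ r k, T (r, c) = Cell.num k ↔ T' (r, c') = Cell.num k) : col T c = col T' c' := by
  have : {k : ℕ | ∃ r, T (r, c) = Cell.num k} = {k : ℕ | ∃ r, T' (r, c') = Cell.num k} := by
    simp only [h]
  rw [col, col]
  by_cases hf : {k : ℕ | ∃ r, T' (r, c') = Cell.num k}.Finite
  · rw [dif_pos hf, dif_pos (this ▸ hf)]
    ext k
    simp [h]
  · rw [dif_neg hf, dif_neg (this ▸ hf)]

theorem Precedes.not_num_bullet {m k : ℕ} (h : Precedes m Cell.bullet (Cell.num k)) (hk : k ≤ m) :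
    False := by
  simp only [Precedes] at h
  omega

section Dotted

variable {m : ℕ} {T : Filling}

theorem IsDottedIncreasing.lt_of_col (h : IsDottedIncreasing m T) {r r' c a b : ℕ}
    (ha : T (r, c) = Cell.num a) (hb : T (r', c) = Cell.num b) (hr : r < r') : a < b := by
  have := h.col r r' c hr (mem_shape_of_num ha) (mem_shape_of_num hb)
  rwa [ha, hb] at this

theorem IsDottedIncreasing.lt_of_row (h : IsDottedIncreasing m T) {r c c' a b : ℕ}
    (ha : T (r, c) = Cell.num a) (hb : T (r, c') = Cell.num b) (hr : c < c') : a < b := by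
  have := h.row r c c' hr (mem_shape_of_num ha) (mem_shape_of_num hb)
  rwa [ha, hb] at this

theorem IsDottedIncreasing.row_unique (h : IsDottedIncreasing m T) {r r' c a : ℕ}
    (ha : T (r, c) = Cell.num a) (hb : T (r', c) = Cell.num a) : r = r' := by
  rcases lt_trichotomy r r' with hr | hr | hr
  · exact absurd (h.lt_of_col ha hb hr) (lt_irrefl _)
  · exact hr
  · exact absurd (h.lt_of_col hb ha hr) (lt_irrefl _)

theorem IsDottedIncreasing.bullet_unique (h : IsDottedIncreasing m T) {r r' c : ℕ}
    (ha : T (r, c) = Cell.bullet) (hb : T (r', c) = Cell.bullet) : r = r' := by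
  rcases lt_trichotomy r r' with hr | hr | hr
  · have := h.col r r' c hr (mem_shape_of_bullet ha) (mem_shape_of_bullet hb)
    rw [ha, hb] at this
    exact this.elim
  · exact hr
  · have := h.col r' r c hr (mem_shape_of_bullet hb) (mem_shape_of_bullet ha)
    rw [ha, hb] at this
    exact this.elim

theorem IsDottedIncreasing.le_of_col_bullet (h : IsDottedIncreasing m T) {r r' c a : ℕ}
    (ha : T (r, c) = Cell.num a) (hb : T (r', c) = Cell.bullet) (hr : r < r') : a ≤ m := by
  have := h.col r r' c hr (mem_shape_of_num ha) (mem_shape_of_bullet hb)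
  rwa [ha, hb] at this

theorem IsDottedIncreasing.lt_of_bullet_col (h : IsDottedIncreasing m T) {r r' c a : ℕ}
    (ha : T (r, c) = Cell.num a) (hb : T (r', c) = Cell.bullet) (hr : r' < r) : m < a := by
  have := h.col r' r c hr (mem_shape_of_bullet hb) (mem_shape_of_num ha)
  rwa [ha, hb] at this

/-- A `•` next to an `m` lies to its right or below it. -/
theorem IsDottedIncreasing.adjacent (h : IsDottedIncreasing m T) {p q : ℕ × ℕ}
    (hp : T p = Cell.num m) (hq : T q = Cell.bullet) (hpq : Adjacent p q) :
    q = (p.1, p.2 + 1) ∨ q = (p.1 + 1, p.2) := by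
  obtain ⟨r, c⟩ := p
  obtain ⟨r', c'⟩ := q
  simp only [Adjacent] at hpq
  rcases hpq with ⟨rfl, rfl | rfl⟩ | ⟨rfl, rfl | rfl⟩
  · have := h.row r c' (c' + 1) (by omega) (mem_shape_of_bullet hq) (mem_shape_of_num hp)
    rw [hp, hq] at this
    exact (this.not_num_bullet le_rfl).elim
  · exact Or.inl rfl
  · exact absurd (h.lt_of_bullet_col hp hq (by omega)) (lt_irrefl _)
  · exact Or.inr rfl

/-- If an `m` and a `•` share a row or a column, they are neighbours. -/
theorem IsDottedIncreasing.adjacent_of_row (h : IsDottedIncreasing m T) {r c c' : ℕ}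
    (hp : T (r, c) = Cell.num m) (hq : T (r, c') = Cell.bullet) (hc : c < c') : c' = c + 1 := by
  by_contra hne
  have hx : (r, c + 1) ∈ shape T := h.skew.mem_of_le_of_le (mem_shape_of_num hp)
    (mem_shape_of_bullet hq) (by simp) (by simp; omega)
  have h1 := h.row r c (c + 1) (by omega) (mem_shape_of_num hp) hx
  have h2 := h.row r (c + 1) c' (by omega) hx (mem_shape_of_bullet hq)
  rw [hp] at h1
  rw [hq] at h2
  rcases bullet_or_num hx with hb | ⟨k, hk⟩
  · rw [hb] at h2; exact h2
  · rw [hk] at h1 h2; simp only [Precedes] at h1 h2; omega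

theorem IsDottedIncreasing.adjacent_of_col (h : IsDottedIncreasing m T) {r r' c : ℕ}
    (hp : T (r, c) = Cell.num m) (hq : T (r', c) = Cell.bullet) (hc : r < r') : r' = r + 1 := by
  by_contra hne
  have hx : (r + 1, c) ∈ shape T := h.skew.mem_of_le_of_le (mem_shape_of_num hp)
    (mem_shape_of_bullet hq) (by simp) (by simp; omega)
  have h1 := h.col r (r + 1) c (by omega) (mem_shape_of_num hp) hx
  have h2 := h.col (r + 1) r' c (by omega) hx (mem_shape_of_bullet hq)
  rw [hp] at h1
  rw [hq] at h2
  rcases bullet_or_num hx with hb | ⟨k, hk⟩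
  · rw [hb] at h2; exact h2
  · rw [hk] at h1 h2; simp only [Precedes] at h1 h2; omega

end Dotted

/-! ### One move -/

theorem Adjacent.symm {p q : ℕ × ℕ} (h : Adjacent p q) : Adjacent q p := by
  simp only [Adjacent] at h ⊢
  omega

section Move

variable {m : ℕ} {T : Filling}

theorem revKjdt_of_empty {p : ℕ × ℕ} (h : T p = Cell.empty) : revKjdt m T p = Cell.empty := by
  simp [revKjdt, h]

theorem revKjdt_of_ne {p : ℕ × ℕ} {k : ℕ} (h : T p = Cell.num k) (hk : k ≠ m) :
    revKjdt m T p = Cell.num k := by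
  simp [revKjdt, h, hk]

theorem revKjdt_of_bullet {p : ℕ × ℕ} (h : T p = Cell.bullet) :
    (revKjdt m T p = Cell.num m ∧ ∃ q, Adjacent p q ∧ T q = Cell.num m) ∨
      (revKjdt m T p = Cell.bullet ∧ ¬ ∃ q, Adjacent p q ∧ T q = Cell.num m) := by
  by_cases hq : ∃ q, Adjacent p q ∧ T q = Cell.num m
  · exact Or.inl ⟨by simp only [revKjdt, h, if_pos hq], hq⟩
  · exact Or.inr ⟨by simp only [revKjdt, h, if_neg hq], hq⟩

theorem revKjdt_of_eq {p : ℕ × ℕ} (h : T p = Cell.num m) :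
    (revKjdt m T p = Cell.bullet ∧ ∃ q, Adjacent p q ∧ T q = Cell.bullet) ∨
      (revKjdt m T p = Cell.num m ∧ ¬ ∃ q, Adjacent p q ∧ T q = Cell.bullet) := by
  by_cases hq : ∃ q, Adjacent p q ∧ T q = Cell.bullet
  · exact Or.inl ⟨by simp only [revKjdt, h]; exact if_pos ⟨rfl, hq⟩, hq⟩
  · exact Or.inr ⟨by simp only [revKjdt, h]; exact if_neg fun h' => hq h'.2, hq⟩

theorem revKjdt_eq_num_of_adjacent {p q : ℕ × ℕ} (hp : T p = Cell.bullet) (hpq : Adjacent p q)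
    (hq : T q = Cell.num m) : revKjdt m T p = Cell.num m :=
  (revKjdt_of_bullet hp).elim (fun h => h.1) fun h => absurd ⟨q, hpq, hq⟩ h.2

theorem shape_revKjdt : shape (revKjdt m T) = shape T := by
  ext p
  simp only [shape, Set.mem_ofPred_eq, ne_eq, not_iff_not]
  refine ⟨fun h => ?_, revKjdt_of_empty⟩
  cases hp : T p with
  | empty => rfl
  | bullet => rcases revKjdt_of_bullet (m := m) hp with h' | h' <;> simp [h'.1] at h
  | num k =>
    by_cases hk : k = m
    · subst hk
      rcases revKjdt_of_eq hp with h' | h' <;> simp [h'.1] at h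
    · simp [revKjdt_of_ne hp hk] at h

theorem revKjdt_eq_num_iff {p : ℕ × ℕ} {k : ℕ} (hk : k ≠ m) :
    revKjdt m T p = Cell.num k ↔ T p = Cell.num k := by
  refine ⟨fun h => ?_, fun h => revKjdt_of_ne h hk⟩
  cases hp : T p with
  | empty => simp [revKjdt_of_empty hp] at h
  | bullet =>
    rcases revKjdt_of_bullet (m := m) hp with h' | h' <;> simp [h'.1] at h
    exact absurd h.symm hk
  | num l =>
    by_cases hl : l = m
    · subst hl
      rcases revKjdt_of_eq hp with h' | h' <;> simp [h'.1] at h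
      exact absurd h.symm hk
    · rw [revKjdt_of_ne hp hl] at h
      exact h

/-- Passing from `m + 1` to `m` reverses only the order of `m + 1` and `•`. A pair `m + 1`, `•` in
this order must therefore be exchanged, which adjacency guarantees. -/
theorem precedes_revKjdt {p q : ℕ × ℕ} (h : Precedes (m + 1) (T p) (T q))
    (ha : T p = Cell.num (m + 1) → T q = Cell.bullet → Adjacent p q) :
    Precedes m (revKjdt (m + 1) T p) (revKjdt (m + 1) T q) := by
  cases hp : T p with
  | empty => simp [hp, Precedes] at h
  | bullet =>
    cases hq : T q with
    | empty => simp [hp, hq, Precedes] at h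
    | bullet => simp [hp, hq, Precedes] at h
    | num b =>
      simp only [hp, hq, Precedes] at h
      rw [revKjdt_of_ne hq (by omega)]
      rcases revKjdt_of_bullet (m := m + 1) hp with h' | h' <;> simp only [h'.1, Precedes] <;> omega
  | num a =>
    cases hq : T q with
    | empty => simp [hp, hq, Precedes] at h
    | bullet =>
      simp only [hp, hq, Precedes] at h
      by_cases e : a = m + 1
      · subst e
        have had := ha hp hq
        rw [revKjdt_eq_num_of_adjacent hq had.symm hp]
        rcases revKjdt_of_eq hp with h' | h'
        · simp [h'.1, Precedes]
        · exact absurd ⟨q, had, hq⟩ h'.2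
      · rw [revKjdt_of_ne hp e]
        rcases revKjdt_of_bullet (m := m + 1) hq with h' | h' <;> simp only [h'.1, Precedes] <;> omega
    | num b =>
      simp only [hp, hq, Precedes] at h
      by_cases e : a = m + 1
      · subst e
        rw [revKjdt_of_ne hq (by omega)]
        rcases revKjdt_of_eq hp with h' | h' <;> simp only [h'.1, Precedes] <;> omega
      · rw [revKjdt_of_ne hp e]
        by_cases e' : b = m + 1
        · subst e'
          rcases revKjdt_of_eq hq with h' | h' <;> simp only [h'.1, Precedes] <;> omega
        · rw [revKjdt_of_ne hq e']
          exact h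

theorem IsDottedIncreasing.revKjdt (h : IsDottedIncreasing (m + 1) T) :
    IsDottedIncreasing m (revKjdt (m + 1) T) where
  skew := by rw [shape_revKjdt]; exact h.skew
  pos p k hk := by
    by_cases e : k = m + 1
    · omega
    · exact h.pos p k ((revKjdt_eq_num_iff e).1 hk)
  row r c c' hc hp hq := by
    rw [shape_revKjdt] at hp hq
    refine precedes_revKjdt (h.row r c c' hc hp hq) fun h1 h2 => ?_
    have := h.adjacent_of_row h1 h2 hc
    simp [Adjacent, this]
  col r r' c hr hp hq := by
    rw [shape_revKjdt] at hp hq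
    refine precedes_revKjdt (h.col r r' c hr hp hq) fun h1 h2 => ?_
    have := h.adjacent_of_col h1 h2 hr
    simp [Adjacent, this]

/-- If `m` enters a column, it comes from the left neighbour. -/
theorem IsDottedIncreasing.exists_of_enters (h : IsDottedIncreasing m T) {c : ℕ}
    (hc : m ∉ IncTab.col T c) (hc' : m ∈ IncTab.col (IncTab.revKjdt m T) c) :
    ∃ r d, c = d + 1 ∧ T (r, d) = Cell.num m ∧ T (r, c) = Cell.bullet := by
  rw [mem_col h.skew.finite] at hc
  rw [mem_col (shape_revKjdt (m := m) (T := T) ▸ h.skew.finite)] at hc'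
  obtain ⟨r, hr⟩ := hc'
  cases hp : T (r, c) with
  | empty => simp [revKjdt_of_empty hp] at hr
  | num k =>
    by_cases hk : k = m
    · exact absurd ⟨r, hk ▸ hp⟩ hc
    · simp [revKjdt_of_ne hp hk] at hr
      exact absurd hr hk
  | bullet =>
    rcases revKjdt_of_bullet (m := m) hp with ⟨-, q, had, hq⟩ | h'
    · rcases h.adjacent hq hp had.symm with e | e
      · rw [Prod.mk.injEq] at e
        refine ⟨r, q.2, e.2, ?_, hp⟩
        rw [e.1]
        exact hq
      · rw [Prod.mk.injEq] at e
        exact absurd ⟨q.1, by rw [e.2]; exact hq⟩ hc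
    · simp [h'.1] at hr

/-- If `m` leaves a column, then it has a `•` on its right and the column contains no `•` below. -/
theorem IsDottedIncreasing.exists_of_leaves (h : IsDottedIncreasing m T) {c : ℕ}
    (hc : m ∈ IncTab.col T c) (hc' : m ∉ IncTab.col (IncTab.revKjdt m T) c) :
    ∃ r, T (r, c) = Cell.num m ∧ T (r, c + 1) = Cell.bullet ∧
      ∀ r', r < r' → T (r', c) ≠ Cell.bullet := by
  rw [mem_col h.skew.finite] at hc
  rw [mem_col (shape_revKjdt (m := m) (T := T) ▸ h.skew.finite)] at hc'
  obtain ⟨r, hr⟩ := hc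
  have hb : ∀ r', r < r' → T (r', c) ≠ Cell.bullet := by
    intro r' hlt hb
    obtain rfl := h.adjacent_of_col hr hb hlt
    exact hc' ⟨_, revKjdt_eq_num_of_adjacent hb (by simp [Adjacent]) hr⟩
  refine ⟨r, hr, ?_, hb⟩
  rcases revKjdt_of_eq hr with ⟨-, q, had, hq⟩ | h'
  · rcases h.adjacent hr hq had with e | e
    · rwa [e] at hq
    · rw [e] at hq
      exact absurd hq (hb _ (by simp))
  · exact absurd ⟨r, h'.1⟩ hc'

/-- Below a row containing `m •`, the left column is at least as long as the right one. -/
theorem IsDottedIncreasing.card_below (h : IsDottedIncreasing m T) {r c : ℕ}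
    (hr : T (r, c) = Cell.num m) (hb : T (r, c + 1) = Cell.bullet)
    (hn : ∀ r', r < r' → T (r', c) ≠ Cell.bullet) (x : ℕ) :
    ((IncTab.col T (c + 1)).filter (fun y => m < y ∧ y ≤ x)).card ≤
      ((IncTab.col T c).filter (fun y => m < y ∧ y < x)).card := by
  have hf := h.skew.finite
  -- Each entry of the right column is matched with its left neighbour. Entries above the `•` are at
  -- most `m`, so only rows below `r` occur.
  refine Finset.card_le_card_of_forall_subsingleton
    (fun b a => ∃ r', r < r' ∧ T (r', c + 1) = Cell.num b ∧ T (r', c) = Cell.num a) ?_ ?_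
  · intro b hb'
    rw [Finset.mem_filter, mem_col hf] at hb'
    obtain ⟨⟨r', hr'⟩, hmb, hbx⟩ := hb'
    have hlt : r < r' := by
      rcases lt_trichotomy r r' with e | e | e
      · exact e
      · subst e; simp [hb] at hr'
      · have := h.le_of_col_bullet hr' hb e; omega
    have hs : (r', c) ∈ shape T := h.skew.mem_of_le_of_le (mem_shape_of_num hr)
      (mem_shape_of_num hr') (by simp; omega) (by simp)
    obtain ⟨a, ha⟩ := (bullet_or_num hs).resolve_left (hn r' hlt)
    refine ⟨a, ?_, r', hlt, hr', ha⟩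
    rw [Finset.mem_filter, mem_col hf]
    exact ⟨⟨r', ha⟩, h.lt_of_col hr ha hlt, (h.lt_of_row ha hr' (by omega)).trans_le hbx⟩
  · rintro a - b ⟨-, r₁, -, hb₁, ha₁⟩ b' ⟨-, r₂, -, hb₂, ha₂⟩
    obtain rfl := h.row_unique ha₁ ha₂
    simpa [hb₁] using hb₂

/-- Left neighbours match the entries as before. The left column may contain one `•` below `m`, and
the row of that `•` is charged to `m` itself. -/
theorem IsDottedIncreasing.card_below_le_succ (h : IsDottedIncreasing m T) {r c : ℕ}
    (hr : T (r, c) = Cell.num m) (hb : T (r, c + 1) = Cell.bullet) (x : ℕ) :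
    ((IncTab.col T (c + 1)).filter (fun y => m < y ∧ y ≤ x)).card ≤
      ((IncTab.col T c).filter (fun y => m < y ∧ y < x)).card + 1 := by
  have hf := h.skew.finite
  rw [← Finset.card_insert_of_notMem (a := m) (by simp)]
  refine Finset.card_le_card_of_forall_subsingleton
    (fun b a => ∃ r', r < r' ∧ T (r', c + 1) = Cell.num b ∧
      (T (r', c) = Cell.num a ∨ T (r', c) = Cell.bullet ∧ a = m)) ?_ ?_
  · intro b hb'
    rw [Finset.mem_filter, mem_col hf] at hb'
    obtain ⟨⟨r', hr'⟩, hmb, hbx⟩ := hb'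
    have hlt : r < r' := by
      rcases lt_trichotomy r r' with e | e | e
      · exact e
      · subst e; simp [hb] at hr'
      · have := h.le_of_col_bullet hr' hb e; omega
    have hs : (r', c) ∈ shape T := h.skew.mem_of_le_of_le (mem_shape_of_num hr)
      (mem_shape_of_num hr') (by simp; omega) (by simp)
    rcases bullet_or_num hs with ha | ⟨a, ha⟩
    · exact ⟨m, Finset.mem_insert_self _ _, r', hlt, hr', Or.inr ⟨ha, rfl⟩⟩
    · refine ⟨a, Finset.mem_insert_of_mem ?_, r', hlt, hr', Or.inl ha⟩
      rw [Finset.mem_filter, mem_col hf]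
      exact ⟨⟨r', ha⟩, h.lt_of_col hr ha hlt, (h.lt_of_row ha hr' (by omega)).trans_le hbx⟩
  · rintro a - b ⟨-, r₁, h₁, hb₁, ha₁⟩ b' ⟨-, r₂, h₂, hb₂, ha₂⟩
    have e : r₁ = r₂ := by
      rcases ha₁ with ha₁ | ⟨ha₁, rfl⟩ <;> rcases ha₂ with ha₂ | ⟨ha₂, e⟩
      · exact h.row_unique ha₁ ha₂
      · subst e
        exact absurd (h.lt_of_col hr ha₁ h₁) (lt_irrefl _)
      · exact absurd (h.lt_of_col hr ha₂ h₂) (lt_irrefl _)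
      · exact h.bullet_unique ha₁ ha₂
    subst e
    simpa [hb₁] using hb₂

/-- Above a row containing `m •`, the right column is at least as long as the left one. -/
theorem IsDottedIncreasing.card_above (h : IsDottedIncreasing m T) {r c : ℕ}
    (hr : T (r, c) = Cell.num m) (hb : T (r, c + 1) = Cell.bullet) (hm : m ∉ IncTab.col T (c + 1))
    (a : ℕ) :
    ((IncTab.col T c).filter (fun y => a ≤ y ∧ y < m)).card ≤
      ((IncTab.col T (c + 1)).filter (fun y => a < y ∧ y < m)).card := by
  have hf := h.skew.finite
  refine Finset.card_le_card_of_forall_subsingleton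
    (fun x b => ∃ r', T (r', c + 1) = Cell.num b ∧ T (r', c) = Cell.num x) ?_ ?_
  · intro x hx
    rw [Finset.mem_filter, mem_col hf] at hx
    obtain ⟨⟨r', hr'⟩, hax, hxm⟩ := hx
    have hlt : r' < r := by
      rcases lt_trichotomy r r' with e | e | e
      · have := h.lt_of_col hr hr' e; omega
      · subst e; simp [hr] at hr'; omega
      · exact e
    have hs : (r', c + 1) ∈ shape T := h.skew.mem_of_le_of_le (mem_shape_of_num hr')
      (mem_shape_of_bullet hb) (by simp) (by simp; omega)
    rcases bullet_or_num hs with hb' | ⟨b, hb'⟩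
    · have := h.bullet_unique hb hb'; omega
    · refine ⟨b, ?_, r', hb', hr'⟩
      have h1 := h.le_of_col_bullet hb' hb hlt
      have h2 := h.lt_of_row hr' hb' (by omega)
      have h3 : b ≠ m := fun e => hm ((mem_col hf).2 ⟨r', e ▸ hb'⟩)
      rw [Finset.mem_filter, mem_col hf]
      exact ⟨⟨r', hb'⟩, by omega, by omega⟩
  · rintro b - x ⟨-, r₁, hb₁, ha₁⟩ x' ⟨-, r₂, hb₂, ha₂⟩
    obtain rfl := h.row_unique hb₁ hb₂
    simpa [ha₁] using ha₂

/-- All numbers of `T` lie in the first `C` columns. -/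
def NumsInCols (C : ℕ) (T : Filling) : Prop := ∀ p k, T p = Cell.num k → p.2 < C

/-- An `m` that turns into `•` reappears to its right or below. Hence a bound on the columns of the
numbers after a move also holds before it. -/
theorem IsDottedIncreasing.exists_num_revKjdt (h : IsDottedIncreasing m T) {p : ℕ × ℕ} {k : ℕ}
    (hp : T p = Cell.num k) : ∃ q k', p.2 ≤ q.2 ∧ IncTab.revKjdt m T q = Cell.num k' := by
  by_cases hk : k = m
  · subst hk
    rcases revKjdt_of_eq hp with ⟨-, q, had, hq⟩ | h'
    · refine ⟨q, k, ?_, revKjdt_eq_num_of_adjacent hq had.symm hp⟩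
      rcases h.adjacent hp hq had with rfl | rfl <;> simp
    · exact ⟨p, k, le_rfl, h'.1⟩
  · exact ⟨p, k, le_rfl, revKjdt_of_ne hp hk⟩

/-- The comparison passes through the unions `D c` of the old and new columns: first `m` is inserted
wherever it enters, then it is removed wherever it leaves. -/
theorem IsDottedIncreasing.prodFrom_revKjdt (h : IsDottedIncreasing m T) (hm : 0 < m) (C : ℕ)
    (hC : NumsInCols C (IncTab.revKjdt m T)) (S : Finset ℕ) :
    prodFrom (IncTab.col (IncTab.revKjdt m T)) S 0 C = prodFrom (IncTab.col T) S 0 C := by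
  set T' := IncTab.revKjdt m T with hT'
  have hf := h.skew.finite
  have hf' : (shape T').Finite := by rw [hT', shape_revKjdt]; exact hf
  have hne : ∀ c k, k ≠ m → (k ∈ IncTab.col T' c ↔ k ∈ IncTab.col T c) := by
    intro c k hk
    rw [mem_col hf, mem_col hf']
    simp only [hT', revKjdt_eq_num_iff hk]
  set D : ℕ → Finset ℕ := fun c => IncTab.col T c ∪ IncTab.col T' c with hD
  have hD1 : ∀ c, (m ∈ IncTab.col T' c → m ∈ IncTab.col T c) → D c = IncTab.col T c := by
    intro c hc
    ext k
    simp only [hD, Finset.mem_union]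
    by_cases hk : k = m
    · subst hk; tauto
    · rw [hne c k hk, or_self]
  have hD2 : ∀ c, (m ∈ IncTab.col T c → m ∈ IncTab.col T' c) → D c = IncTab.col T' c := by
    intro c hc
    ext k
    simp only [hD, Finset.mem_union]
    by_cases hk : k = m
    · subst hk; tauto
    · rw [hne c k hk, or_self]
  have hins : ∀ c, m ∈ IncTab.col T' c → D c = insert m (IncTab.col T c) := by
    intro c hc
    ext k
    simp only [hD, Finset.mem_union, Finset.mem_insert]
    by_cases hk : k = m
    · subst hk; tauto
    · rw [hne c k hk, or_self]; tauto
  have h1 : prodFrom D S 0 C = prodFrom (IncTab.col T) S 0 C := by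
    refine prodFrom_enlarge S ?_ C 0 ?_
    · intro c hc
      have hc' : m ∈ IncTab.col T' (c + 1) ∧ m ∉ IncTab.col T (c + 1) := by
        by_contra hcon
        exact hc (hD1 _ (by tauto))
      obtain ⟨r, d, hd, hr, hb⟩ := h.exists_of_enters hc'.2 hc'.1
      obtain rfl : c = d := by omega
      have hmc : m ∈ IncTab.col T c := (mem_col hf).2 ⟨r, hr⟩
      refine ⟨hD1 c fun _ => hmc, fun U => ?_⟩
      rw [hins _ hc'.1]
      exact tri_tri_insert hm hmc hc'.2 (h.card_below_le_succ hr hb)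
        fun a _ _ => h.card_above hr hb hc'.2 a
    · refine hD1 0 fun h0 => ?_
      by_contra h0'
      obtain ⟨r, d, hd, -⟩ := h.exists_of_enters h0' h0
      omega
  rw [← h1]
  refine (prodFrom_shrink S (C := C) ?_ ?_ C 0 (by omega)).symm
  · intro c hc U hU
    by_cases hl : m ∈ IncTab.col T c → m ∈ IncTab.col T' c
    · rw [hD2 c hl]
    · rw [Classical.not_imp] at hl
      obtain ⟨r, hr, hb, hn⟩ := h.exists_of_leaves hl.1 hl.2
      have e1 : D c = IncTab.col T c := hD1 c fun _ => hl.1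
      have e2 : IncTab.col T' c = (IncTab.col T c).erase m := by
        ext k
        rw [Finset.mem_erase]
        by_cases hk : k = m
        · subst hk; tauto
        · rw [hne c k hk]; tauto
      rw [e1, e2]
      -- Only customers above `m` matter here, and among those values `D (c + 1)` agrees with the
      -- old column.
      refine (tri_erase m fun x => le_trans (Finset.card_le_card ?_) (h.card_below hr hb hn x)).symm
      intro k hk
      rw [Finset.mem_filter] at hk ⊢
      refine ⟨?_, hk.2⟩
      have := hU hk.1
      simp only [hD, Finset.mem_union] at this
      rwa [hne _ k (by omega), or_self] at this
  · intro c hc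
    refine hD2 c fun hm1 => ?_
    by_contra hm2
    obtain ⟨r, hr, hb, -⟩ := h.exists_of_leaves hm1 hm2
    -- Leaving the last column would put `m` into column `C`, counted from `0`.
    have := hC (r, c + 1) m (revKjdt_eq_num_of_adjacent hb (by simp [Adjacent]) hr)
    simp at this
    omega

end Move

/-! ### One round -/

theorem IsDottedIncreasing.revKjdtAll : ∀ {m : ℕ} {T : Filling}, IsDottedIncreasing m T →
    IsDottedIncreasing 0 (revKjdtAll m T)
  | 0, _, h => h
  | m + 1, _, h => IsDottedIncreasing.revKjdtAll (m := m) h.revKjdt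

theorem shape_revKjdtAll : ∀ (m : ℕ) (T : Filling), shape (revKjdtAll m T) = shape T
  | 0, _ => rfl
  | m + 1, _ => (shape_revKjdtAll m _).trans shape_revKjdt

theorem IsDottedIncreasing.exists_num_revKjdtAll {p : ℕ × ℕ} : ∀ {m : ℕ} {T : Filling} {k : ℕ},
    IsDottedIncreasing m T → (∃ q, p.2 ≤ q.2 ∧ T q = Cell.num k) →
      ∃ q k', p.2 ≤ q.2 ∧ IncTab.revKjdtAll m T q = Cell.num k'
  | 0, _, k, _, ⟨q, hq, hk⟩ => ⟨q, k, hq, hk⟩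
  | m + 1, _, _, h, ⟨_, hq, hk⟩ => by
    obtain ⟨q', k', h1, h2⟩ := h.exists_num_revKjdt hk
    exact IsDottedIncreasing.exists_num_revKjdtAll (m := m) h.revKjdt ⟨q', hq.trans h1, h2⟩

theorem IsDottedIncreasing.prodFrom_revKjdtAll {C : ℕ} (S : Finset ℕ) : ∀ {m : ℕ} {T : Filling},
    IsDottedIncreasing m T → NumsInCols C (IncTab.revKjdtAll m T) →
      prodFrom (IncTab.col (IncTab.revKjdtAll m T)) S 0 C = prodFrom (IncTab.col T) S 0 C
  | 0, _, _, _ => rfl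
  | m + 1, T, h, hC => by
    rw [IncTab.revKjdtAll, IsDottedIncreasing.prodFrom_revKjdtAll S h.revKjdt hC]
    refine h.prodFrom_revKjdt (by omega) C (fun p k hp => ?_) S
    by_contra hlt
    obtain ⟨q, k', h1, h2⟩ := h.revKjdt.exists_num_revKjdtAll ⟨p, le_rfl, hp⟩
    have := hC q k' h2
    omega

/-- A `•` only travels left or up, so the columns to the right of `j` keep their cells when the `•`s
are deleted. -/
theorem IsDottedIncreasing.bullet_revKjdtAll {j : ℕ} : ∀ {m : ℕ} {T : Filling},
    IsDottedIncreasing m T → (∀ p, T p = Cell.bullet → p.2 ≤ j) →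
      ∀ p, IncTab.revKjdtAll m T p = Cell.bullet → p.2 ≤ j
  | 0, _, _, hb => hb
  | m + 1, T, h, hb => by
    refine IsDottedIncreasing.bullet_revKjdtAll (m := m) h.revKjdt fun p hp => ?_
    have hs : p ∈ shape T := by
      rw [← shape_revKjdt (m := m + 1)]
      exact mem_shape_of_bullet hp
    rcases bullet_or_num hs with hp' | ⟨k, hk⟩
    · exact hb p hp'
    · by_cases e : k = m + 1
      · subst e
        rcases revKjdt_of_eq hk with ⟨-, q, had, hq⟩ | h'
        · have := hb q hq
          rcases h.adjacent hk hq had with rfl | rfl <;> simp at this <;> omega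
        · simp [h'.1] at hp
      · simp [revKjdt_of_ne hk e] at hp

/-! ### Adding and deleting `•`s. -/

theorem removeBullets_eq_num {T : Filling} {p : ℕ × ℕ} {k : ℕ} :
    removeBullets T p = Cell.num k ↔ T p = Cell.num k := by
  cases h : T p <;> simp [removeBullets, h]

theorem removeBullets_ne_bullet {T : Filling} (p : ℕ × ℕ) : removeBullets T p ≠ Cell.bullet := by
  cases h : T p <;> simp [removeBullets, h]

theorem mem_shape_removeBullets {T : Filling} {p : ℕ × ℕ} :
    p ∈ shape (removeBullets T) ↔ ∃ k, T p = Cell.num k := by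
  cases h : T p <;> simp [shape, removeBullets, h]

theorem addBullets_eq_num {T : Filling} {B : Finset (ℕ × ℕ)} (hB : ∀ p ∈ B, T p = Cell.empty)
    {p : ℕ × ℕ} {k : ℕ} : addBullets T B p = Cell.num k ↔ T p = Cell.num k := by
  by_cases h : p ∈ B <;> simp [addBullets, h]
  simp [hB p h]

/-- A filling by numbers, strictly increasing along rows and down columns. -/
structure IsIncreasingFilling (T : Filling) : Prop where
  no_bullet : ∀ p, T p ≠ Cell.bullet
  pos : ∀ p k, T p = Cell.num k → 0 < k
  row : ∀ r c c' a b, c < c' → T (r, c) = Cell.num a → T (r, c') = Cell.num b → a < b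
  col : ∀ r r' c a b, r < r' → T (r, c) = Cell.num a → T (r', c) = Cell.num b → a < b

theorem IsIncreasingFilling.exists_num {T : Filling} (h : IsIncreasingFilling T) {p : ℕ × ℕ}
    (hp : p ∈ shape T) : ∃ k, T p = Cell.num k :=
  (bullet_or_num hp).resolve_left (h.no_bullet p)

theorem IsDottedIncreasing.removeBullets {m : ℕ} {T : Filling} (h : IsDottedIncreasing m T) :
    IsIncreasingFilling (removeBullets T) where
  no_bullet := removeBullets_ne_bullet
  pos p k hp := h.pos p k (removeBullets_eq_num.1 hp)
  row _ _ _ _ _ hc ha hb := h.lt_of_row (removeBullets_eq_num.1 ha) (removeBullets_eq_num.1 hb) hc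
  col _ _ _ _ _ hr ha hb := h.lt_of_col (removeBullets_eq_num.1 ha) (removeBullets_eq_num.1 hb) hr

theorem AntiRectStep.isIncreasingFilling {T T' : Filling} (h : AntiRectStep T T') :
    IsIncreasingFilling T' := by
  obtain ⟨m, B, -, hB, rfl⟩ := h
  exact hB.2.revKjdtAll.removeBullets

theorem AntiRectStep.exists_num {T T' : Filling} (h : AntiRectStep T T') {p : ℕ × ℕ} {k : ℕ}
    (hp : T p = Cell.num k) : ∃ q k', p.2 ≤ q.2 ∧ T' q = Cell.num k' := by
  obtain ⟨m, B, -, hB, rfl⟩ := h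
  obtain ⟨q, k', h1, h2⟩ :=
    hB.2.exists_num_revKjdtAll ⟨p, le_rfl, (addBullets_eq_num hB.1).2 hp⟩
  exact ⟨q, k', h1, removeBullets_eq_num.2 h2⟩

theorem AntiRectStep.numsInCols {T T' : Filling} (h : AntiRectStep T T') {C : ℕ}
    (hC : NumsInCols C T') : NumsInCols C T := by
  intro p k hp
  obtain ⟨q, k', h1, h2⟩ := h.exists_num hp
  exact h1.trans_lt (hC q k' h2)

theorem AntiRectStep.prodFrom_eq {T T' : Filling} (h : AntiRectStep T T') {C : ℕ}
    (hC : NumsInCols C T') (S : Finset ℕ) :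
    prodFrom (col T') S 0 C = prodFrom (col T) S 0 C := by
  obtain ⟨m, B, -, hB, rfl⟩ := h
  have h1 : col (slide m T B) = col (revKjdtAll m (addBullets T B)) :=
    funext fun c => col_congr fun r k => removeBullets_eq_num
  have h2 : col (addBullets T B) = col T :=
    funext fun c => col_congr fun r k => addBullets_eq_num hB.1
  rw [h1, hB.2.prodFrom_revKjdtAll S fun p k hp => hC p k (removeBullets_eq_num.2 hp), h2]

theorem numsInCols_and_prodFrom_eq_of_reflTransGen {T Q : Filling}
    (h : Relation.ReflTransGen AntiRectStep T Q) {C : ℕ} (hC : NumsInCols C Q) (S : Finset ℕ) :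
    NumsInCols C T ∧ prodFrom (col Q) S 0 C = prodFrom (col T) S 0 C := by
  induction h using Relation.ReflTransGen.head_induction_on with
  | refl => exact ⟨hC, rfl⟩
  | head h _ ih => exact ⟨h.numsInCols ih.1, ih.2.trans (h.prodFrom_eq ih.1 S)⟩

/-! ### Anti-normal shapes -/

theorem IsAntiNormal.finite {Q : Filling} (h : IsAntiNormal Q) : (shape Q).Finite := by
  obtain ⟨R, C, h⟩ := h
  refine (Finset.range R ×ˢ Finset.range C).finite_toSet.subset fun p hp => ?_
  have := h p hp
  simp only [Finset.coe_product, Finset.coe_range, Set.mem_prod, Set.mem_Iio]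
  exact ⟨this.1, this.2.1⟩

theorem HasRightmostColumn.numsInCols {Q : Filling} {C : ℕ} (h : HasRightmostColumn Q C) :
    NumsInCols C Q := fun p _ hp => h.1 p (mem_shape_of_num hp)

/-- Below its last column, an anti-normal shape is closed under moving right. -/
theorem IsAntiNormal.succ_mem {Q : Filling} {C : ℕ} (h : IsAntiNormal Q)
    (hC : HasRightmostColumn Q C) {r c : ℕ} (hp : (r, c) ∈ shape Q) (hc : c + 1 < C) :
    (r, c + 1) ∈ shape Q := by
  obtain ⟨R, C', h⟩ := h
  -- Minimality of `C` gives a cell in the last column, so the rectangle of the anti-normal shape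
  -- has width at least `C`.
  have h1 : ∃ p ∈ shape Q, C - 1 ≤ p.2 := by
    by_contra hcon
    push Not at hcon
    have : C ≤ C - 1 := hC.2 hcon
    omega
  obtain ⟨p, hp', hpC⟩ := h1
  have h2 := (h p hp').2.1
  have h3 := h _ hp
  exact h3.2.2 _ (by simp) h3.1 (by simp; omega)

/-- Each column of an anti-normal increasing filling is fully used by the next one. -/
theorem IsAntiNormal.tri_col_succ {Q : Filling} {C : ℕ} (h : IsAntiNormal Q)
    (hC : HasRightmostColumn Q C) (hQ : IsIncreasingFilling Q) {c : ℕ} (hc : c + 1 < C) :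
    tri (col Q c) (col Q (c + 1)) = col Q c := by
  have hf := h.finite
  refine tri_eq_left fun a _ => ?_
  refine Finset.card_le_card_of_forall_subsingleton
    (fun x b => ∃ r, Q (r, c + 1) = Cell.num b ∧ Q (r, c) = Cell.num x) ?_ ?_
  · intro x hx
    rw [Finset.mem_filter, mem_col hf] at hx
    obtain ⟨⟨r, hr⟩, hax⟩ := hx
    obtain ⟨b, hb⟩ := hQ.exists_num (h.succ_mem hC (mem_shape_of_num hr) hc)
    refine ⟨b, ?_, r, hb, hr⟩
    rw [Finset.mem_filter, mem_col hf]
    exact ⟨⟨r, hb⟩, hax.trans_lt (hQ.row r c (c + 1) x b (by omega) hr hb)⟩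
  · rintro b - x ⟨-, r₁, hb₁, ha₁⟩ x' ⟨-, r₂, hb₂, ha₂⟩
    obtain rfl : r₁ = r₂ := by
      rcases lt_trichotomy r₁ r₂ with e | e | e
      · exact absurd (hQ.col _ _ _ _ _ e hb₁ hb₂) (lt_irrefl _)
      · exact e
      · exact absurd (hQ.col _ _ _ _ _ e hb₂ hb₁) (lt_irrefl _)
    simpa [ha₁] using ha₂

theorem IsAntiNormal.prodFrom_eq_col {Q : Filling} {C N : ℕ} (h : IsAntiNormal Q)
    (hC : HasRightmostColumn Q C) (hQ : IsIncreasingFilling Q) (hN : ∀ x ∈ col Q (C - 1), x < N) :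
    ∀ n a, a + (n + 1) = C → prodFrom (col Q) (Finset.Ico N (2 * N)) a (n + 1) = col Q a := by
  intro n
  induction n with
  | zero =>
    intro a ha
    obtain rfl : a = C - 1 := by omega
    exact tri_Ico_eq_left hN
  | succ n ih =>
    intro a ha
    rw [prodFrom, ih (a + 1) (by omega)]
    exact h.tri_col_succ hC hQ (by omega)

theorem exists_forall_lt (A : Finset ℕ) : ∃ N, ∀ x ∈ A, x < N :=
  ⟨A.sup id + 1, fun _ hx => Nat.lt_succ_of_le (Finset.le_sup (f := id) hx)⟩

/-- The first column of an anti-rectification. -/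
theorem IsAntiRectification.col_zero_eq {P Q : Filling} {C : ℕ} (h : IsAntiRectification P Q)
    (hP : IsIncreasingFilling P) (hC : HasRightmostColumn Q C) : col Q 0 = colProd P C := by
  rcases Nat.eq_zero_or_pos C with rfl | hpos
  · have : col Q 0 = ∅ := by
      rw [Finset.eq_empty_iff_forall_notMem]
      intro k hk
      rw [mem_col h.2.finite] at hk
      obtain ⟨r, hr⟩ := hk
      exact Nat.not_lt_zero _ (hC.1 _ (mem_shape_of_num hr))
    rw [this]
    rfl
  · have hQ : IsIncreasingFilling Q := by
      rcases Relation.ReflTransGen.cases_tail h.1 with rfl | ⟨T, -, hT⟩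
      · exact hP
      · exact hT.isIncreasingFilling
    obtain ⟨N, hN⟩ := exists_forall_lt (col P (C - 1) ∪ col Q (C - 1))
    rw [colProd_eq_prodFrom P hpos fun x hx => hN x (Finset.mem_union_left _ hx),
      ← (numsInCols_and_prodFrom_eq_of_reflTransGen h.1 hC.numsInCols _).2]
    obtain ⟨n, rfl⟩ : ∃ n, C = n + 1 := ⟨C - 1, by omega⟩
    exact (h.2.prodFrom_eq_col hC hQ (fun x hx => hN x (Finset.mem_union_right _ hx)) n 0
      (by omega)).symm

/-! ### Anti-rectification in a rectangle -/

theorem LeftmostStep.antiRectStep {R C : ℕ} {T T' : Filling} (h : LeftmostStep R C T T') :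
    AntiRectStep T T' := by
  obtain ⟨m, p, h1, -, -, h2, -, h3⟩ := h
  exact ⟨m, {p}, h1, h2, h3⟩

theorem LeftmostStep.shape_lt {R C : ℕ} {T T' : Filling} (h : LeftmostStep R C T T')
    (hT : ∀ p ∈ shape T, p.2 < C) : ∀ p ∈ shape T', p.2 < C := by
  obtain ⟨m, q, -, -, hq, -, -, rfl⟩ := h
  intro p hp
  obtain ⟨k, hk⟩ := mem_shape_removeBullets.1 hp
  have hs := mem_shape_of_num hk
  rw [shape_revKjdtAll] at hs
  by_cases e : p = q
  · rwa [e]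
  · refine hT p ?_
    simpa [shape, addBullets, e] using hs

theorem hasRightmostColumn_of_reflTransGen {R C : ℕ} {T Q : Filling}
    (h : Relation.ReflTransGen (LeftmostStep R C) T Q) (hT : ∀ p ∈ shape T, p.2 < C)
    (hn : ∃ p k, C ≤ p.2 + 1 ∧ T p = Cell.num k) : HasRightmostColumn Q C := by
  have key : (∀ p ∈ shape Q, p.2 < C) ∧ ∃ p k, C ≤ p.2 + 1 ∧ Q p = Cell.num k := by
    induction h with
    | refl => exact ⟨hT, hn⟩
    | tail _ h ih =>
      obtain ⟨h1, p, k, hp, hk⟩ := ih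
      obtain ⟨q, k', hq, hk'⟩ := h.antiRectStep.exists_num hk
      exact ⟨h.shape_lt h1, q, k', by omega, hk'⟩
  obtain ⟨h1, p, k, hp, hk⟩ := key
  exact ⟨h1, fun n hn => by have := hn p (mem_shape_of_num hk); omega⟩

/-- The Young diagram with given column lengths, inside a rectangle. -/
def diagramOfColLens (R C : ℕ) (f : ℕ → ℕ) (hf : Antitone f) : YoungDiagram where
  cells := (Finset.range R ×ˢ Finset.range C).filter (fun p => p.1 < f p.2)
  isLowerSet := by
    rintro ⟨r, c⟩ ⟨r', c'⟩ hle hp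
    rw [Prod.mk_le_mk] at hle
    have := hf hle.2
    simp only [Finset.coe_filter, Finset.mem_product, Finset.mem_range, Set.mem_ofPred_eq] at hp ⊢
    omega

theorem mem_diagramOfColLens {R C : ℕ} {f : ℕ → ℕ} {hf : Antitone f} {p : ℕ × ℕ} :
    p ∈ diagramOfColLens R C f hf ↔ (p.1 < R ∧ p.2 < C) ∧ p.1 < f p.2 := by
  rw [← YoungDiagram.mem_cells]
  simp [diagramOfColLens]

theorem isSkewShape_of_antitone {R C : ℕ} {t h : ℕ → ℕ} (ht : Antitone t) (hh : Antitone h)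
    (hR : ∀ c, h c ≤ R) (hC : ∀ c, C ≤ c → h c = 0) {s : Set (ℕ × ℕ)}
    (hs : ∀ r c, (r, c) ∈ s ↔ t c ≤ r ∧ r < h c) : IsSkewShape s := by
  -- Truncating `t` by `h` puts the inner diagram inside the outer one; columns with `h c ≤ t c` are
  -- empty either way.
  refine ⟨diagramOfColLens R C h hh, diagramOfColLens R C (fun c => min (t c) (h c)) (ht.min hh),
    ?_, ?_⟩
  · intro p hp
    have hp' := mem_diagramOfColLens.1 ((YoungDiagram.mem_cells _).1 hp)
    exact (YoungDiagram.mem_cells _).2 (mem_diagramOfColLens.2 ⟨hp'.1, by omega⟩)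
  · ext ⟨r, c⟩
    rw [hs]
    simp only [Set.mem_ofPred_eq, mem_diagramOfColLens]
    have h1 := hR c
    have h2 := hC c
    omega

/-- The fillings met while filling up the `R` by `C` rectangle from the left: column `c` consists
of the rows from `t c` to `h c - 1`, and nothing has been moved to the right of the first column
that does not reach the bottom. -/
structure IsPartialAntiRect (R C : ℕ) (T : Filling) (t h : ℕ → ℕ) : Prop where
  increasing : IsIncreasingFilling T
  mem_shape : ∀ r c, (r, c) ∈ shape T ↔ t c ≤ r ∧ r < h c
  antitone_top : Antitone t
  antitone_len : Antitone h
  len_le : ∀ c, h c ≤ R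
  len_eq_zero : ∀ c, C ≤ c → h c = 0
  top_lt_len : ∀ c, c < C → t c < h c
  top_eq_zero : ∀ c, h c < R → t (c + 1) = 0

section Partial

variable {R C : ℕ} {T : Filling} {t h : ℕ → ℕ}

theorem IsPartialAntiRect.finite (hT : IsPartialAntiRect R C T t h) : (shape T).Finite :=
  (isSkewShape_of_antitone hT.antitone_top hT.antitone_len hT.len_le hT.len_eq_zero
    hT.mem_shape).finite

theorem IsPartialAntiRect.lt_of_mem (hT : IsPartialAntiRect R C T t h) {p : ℕ × ℕ}
    (hp : p ∈ shape T) : p.2 < C := by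
  by_contra hlt
  have h1 := (hT.mem_shape p.1 p.2).1 hp
  have h2 := hT.len_eq_zero p.2 (by omega)
  omega

theorem exists_entriesLE (hf : (shape T).Finite) : ∃ m, EntriesLE m T := by
  obtain ⟨m, hm⟩ := (hf.image fun p => match T p with | Cell.num k => k | _ => 0).bddAbove
  refine ⟨m, fun p k hp => hm ⟨p, mem_shape_of_num hp, ?_⟩⟩
  simp [hp]

theorem IsPartialAntiRect.isAntiNormal (hT : IsPartialAntiRect R C T t h)
    (hR : ∀ c, c < C → h c = R) : IsAntiNormal T := by
  refine ⟨R, C, fun p hp => ?_⟩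
  have h1 := (hT.mem_shape p.1 p.2).1 hp
  have h2 := hT.len_le p.2
  refine ⟨by omega, hT.lt_of_mem hp, fun q hpq hq1 hq2 => (hT.mem_shape q.1 q.2).2 ?_⟩
  have h3 := hT.antitone_top hpq.2
  have h4 := hpq.1
  rw [hR q.2 hq2]
  omega

theorem addBullets_singleton_of_ne {p q : ℕ × ℕ} (hq : q ≠ p) : addBullets T {p} q = T q := by
  simp [addBullets, hq]

theorem addBullets_singleton_self {p : ℕ × ℕ} : addBullets T {p} p = Cell.bullet := by
  simp [addBullets]

theorem mem_shape_addBullets_singleton {p q : ℕ × ℕ} :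
    q ∈ shape (addBullets T {p}) ↔ q = p ∨ q ∈ shape T := by
  by_cases e : q = p <;> simp [shape, addBullets, e]

theorem IsPartialAntiRect.antitone_update (hT : IsPartialAntiRect R C T t h) {j : ℕ}
    (hjR : h j < R) (hlt : ∀ c, c < j → h c = R) : Antitone (Function.update h j (h j + 1)) := by
  intro c c' hc
  have h1 := hT.antitone_len hc
  have h2 := hlt c
  simp only [Function.update_apply]
  split_ifs with e1 e2 e2
  · omega
  · subst e1; have := h2 (by omega); omega
  · subst e2; omega
  · exact h1

theorem IsPartialAntiRect.mem_shape_addBullets (hT : IsPartialAntiRect R C T t h) {j : ℕ} (hj : j < C)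
    (r c : ℕ) : (r, c) ∈ shape (addBullets T {(h j, j)}) ↔
      t c ≤ r ∧ r < Function.update h j (h j + 1) c := by
  have := hT.top_lt_len j hj
  rw [mem_shape_addBullets_singleton, hT.mem_shape, Prod.mk.injEq, Function.update_apply]
  split_ifs with e
  · subst e; omega
  · omega

/-- The `•` directly below column `j` is last in its row and column, and it exceeds all entries
because these are at most `m`. -/
theorem IsPartialAntiRect.canAdd (hT : IsPartialAntiRect R C T t h) {m j : ℕ} (hm : EntriesLE m T)
    (hj : j < C) (hjR : h j < R) (hlt : ∀ c, c < j → h c = R) : CanAdd m T {(h j, j)} := by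
  have hv : (h j, j) ∉ shape T := fun hs => by
    have := (hT.mem_shape _ _).1 hs
    omega
  have hv' : ∀ p ∈ ({(h j, j)} : Finset (ℕ × ℕ)), T p = Cell.empty := by
    intro p hp
    rw [Finset.mem_singleton] at hp
    subst hp
    by_contra hne
    exact hv hne
  have hsh := hT.mem_shape_addBullets hj
  have hprec : ∀ p q, p ≠ (h j, j) → p ∈ shape (addBullets T {(h j, j)}) →
      q ∈ shape (addBullets T {(h j, j)}) →
      (∀ a b, T p = Cell.num a → T q = Cell.num b → a < b) →
      Precedes m (addBullets T {(h j, j)} p) (addBullets T {(h j, j)} q) := by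
    intro p q hpne hp hq hab
    have hp' := (mem_shape_addBullets_singleton.1 hp).resolve_left hpne
    obtain ⟨a, ha⟩ := hT.increasing.exists_num hp'
    rw [addBullets_singleton_of_ne hpne, ha]
    rcases mem_shape_addBullets_singleton.1 hq with rfl | hq'
    · rw [addBullets_singleton_self]
      exact hm p a ha
    · obtain ⟨b, hb⟩ := hT.increasing.exists_num hq'
      rw [addBullets_singleton_of_ne (by rintro rfl; exact hv hq'), hb]
      exact hab a b ha hb
  refine ⟨hv', ⟨?_, ?_, ?_, ?_⟩⟩
  · refine isSkewShape_of_antitone (R := R) (C := C) hT.antitone_top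
      (hT.antitone_update hjR hlt) ?_ ?_ hsh
    · intro c
      have := hT.len_le c
      rw [Function.update_apply]
      split_ifs <;> omega
    · intro c hc
      rw [Function.update_of_ne (by omega)]
      exact hT.len_eq_zero c hc
  · exact fun p k hp => hT.increasing.pos p k ((addBullets_eq_num hv').1 hp)
  · intro r c c' hc hp hq
    refine hprec _ _ ?_ hp hq fun a b ha hb => hT.increasing.row r c c' a b hc ha hb
    intro e
    rw [Prod.mk.injEq] at e
    obtain ⟨rfl, rfl⟩ := e
    have h1 := ((hsh _ _).1 hq).2
    rw [Function.update_of_ne (by omega)] at h1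
    have := hT.antitone_len hc.le
    omega
  · intro r r' c hr hp hq
    refine hprec _ _ ?_ hp hq fun a b ha hb => hT.increasing.col r r' c a b hr ha hb
    intro e
    rw [Prod.mk.injEq] at e
    obtain ⟨rfl, rfl⟩ := e
    have h1 := ((hsh _ _).1 hq).2
    rw [Function.update_self] at h1
    omega

/-- No `•` can be added in a column that reaches the bottom of the rectangle. -/
theorem IsPartialAntiRect.not_canAdd (hT : IsPartialAntiRect R C T t h) {m : ℕ} (hm : EntriesLE m T)
    {q : ℕ × ℕ} (hqR : q.1 < R) (hqC : q.2 < C) (hq : h q.2 = R) : ¬ CanAdd m T {q} := by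
  intro hadd
  have hlt := hT.top_lt_len q.2 hqC
  -- The column is nonempty and reaches the bottom, so a `•` in it would lie above a number that is
  -- at most `m`.
  have hs : (R - 1, q.2) ∈ shape T := (hT.mem_shape _ _).2 (by omega)
  obtain ⟨k, hk⟩ := hT.increasing.exists_num hs
  have hqe := hadd.1 q (Finset.mem_singleton_self q)
  have hne : (R - 1, q.2) ≠ q := by
    intro e
    rw [e, hqe] at hk
    cases hk
  have hq1 : q.1 < R - 1 := by
    have : q.1 ≠ R - 1 := fun e => hne (by rw [← e])
    omega
  have h1 : addBullets T {q} (R - 1, q.2) = Cell.num k := by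
    rw [addBullets_singleton_of_ne hne, hk]
  have h2 := hadd.2.lt_of_bullet_col h1 (r' := q.1) addBullets_singleton_self hq1
  have h3 := hm _ _ hk
  omega

/-- The `•` goes below the first column that does not reach the bottom. That column gets one cell
longer, and the tops of columns up to `j` may drop by one. Nonemptiness of the product is carried
along to keep the columns from emptying. -/
theorem IsPartialAntiRect.exists_step (hT : IsPartialAntiRect R C T t h) {S : Finset ℕ}
    (hS : (prodFrom (col T) S 0 C).Nonempty) {j : ℕ} (hj : j < C) (hjR : h j < R)
    (hlt : ∀ c, c < j → h c = R) :
    ∃ T' t', LeftmostStep R C T T' ∧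
      IsPartialAntiRect R C T' t' (Function.update h j (h j + 1)) ∧
      (prodFrom (col T') S 0 C).Nonempty := by
  obtain ⟨m, hm⟩ := exists_entriesLE hT.finite
  have hadd := hT.canAdd hm hj hjR hlt
  have hstep : LeftmostStep R C T (slide m T {(h j, j)}) := by
    refine ⟨m, (h j, j), hm, hjR, hj, hadd, fun q hq1 hq2 hq => ?_, rfl⟩
    by_contra hcon
    exact hT.not_canAdd hm hq1 hq2 (hlt _ (by simpa using hcon)) hq
  set T₁ := revKjdtAll m (addBullets T {(h j, j)}) with hT₁
  set h' := Function.update h j (h j + 1) with hh'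
  have hd : IsDottedIncreasing 0 T₁ := hadd.2.revKjdtAll
  have hsh : ∀ r c, (r, c) ∈ shape T₁ ↔ t c ≤ r ∧ r < h' c := by
    intro r c
    rw [hT₁, shape_revKjdtAll]
    exact hT.mem_shape_addBullets hj r c
  have hcol : ∀ p, T₁ p = Cell.bullet → p.2 ≤ j := by
    refine hadd.2.bullet_revKjdtAll fun p hp => ?_
    by_cases e : p = (h j, j)
    · rw [e]
    · rw [addBullets_singleton_of_ne e] at hp
      exact absurd hp (hT.increasing.no_bullet p)
  -- After the last move `•` precedes every positive number, so it can only be the top cell of its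
  -- column.
  have htop : ∀ r c, T₁ (r, c) = Cell.bullet → r = t c := by
    intro r c hb
    have h1 := (hsh r c).1 (mem_shape_of_bullet hb)
    by_contra hne
    have hs : (t c, c) ∈ shape T₁ := (hsh _ _).2 (by omega)
    have h2 := hd.col (t c) r c (by omega) hs (mem_shape_of_bullet hb)
    rcases bullet_or_num hs with hb' | ⟨k, hk⟩
    · rw [hb, hb'] at h2; exact h2
    · rw [hb, hk] at h2
      have := hd.pos _ _ hk
      simp only [Precedes] at h2
      omega
  classical
  set t' : ℕ → ℕ := fun c => if T₁ (t c, c) = Cell.bullet then t c + 1 else t c with ht'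
  have hlen : ∀ c, c < j → h' c = R := fun c hc => by
    rw [hh', Function.update_of_ne (by omega)]; exact hlt c hc
  have hlen' : ∀ c, c ≠ j → h' c = h c := fun c hc => Function.update_of_ne hc _ _
  have hlenj : h' j = h j + 1 := Function.update_self _ _ _
  have htr : ∀ c, j < c → t' c = t c := fun c hc =>
    if_neg fun hb => by have := hcol _ hb; simp at this; omega
  have htle : ∀ c, t' c ≤ t c + 1 := fun c => by
    simp only [ht']; split_ifs <;> omega
  have hanti : Antitone t' := by
    -- Monotonicity could fail only if two neighbouring columns had equal tops and only the right
    -- one began with `•`. A number would then precede `•` in a row, impossible once `m = 0`.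
    refine antitone_nat_of_succ_le fun c => ?_
    have h1 : t (c + 1) ≤ t c := hT.antitone_top (Nat.le_succ c)
    by_contra hcon
    have h2 : T₁ (t (c + 1), c + 1) = Cell.bullet := by
      by_contra hne
      simp only [ht', if_neg hne] at hcon
      split_ifs at hcon <;> omega
    have h3 : ¬ T₁ (t c, c) = Cell.bullet := by
      intro hb
      simp only [ht', if_pos hb, if_pos h2] at hcon
      omega
    have h4 : t (c + 1) = t c := by
      simp only [ht', if_neg h3, if_pos h2] at hcon
      omega
    have h5 : c + 1 ≤ j := hcol _ h2
    have h6 := hT.top_lt_len c (by omega)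
    have hs : (t c, c) ∈ shape T₁ := (hsh _ _).2 (by rw [hlen' c (by omega)]; omega)
    obtain ⟨k, hk⟩ := (bullet_or_num hs).resolve_left h3
    rw [h4] at h2
    have h7 := hd.row (t c) c (c + 1) (by omega) hs (mem_shape_of_bullet h2)
    rw [hk, h2] at h7
    have := hd.pos _ _ hk
    simp only [Precedes] at h7
    omega
  have hmem : ∀ r c, (r, c) ∈ shape (slide m T {(h j, j)}) ↔ t' c ≤ r ∧ r < h' c := by
    intro r c
    rw [slide, mem_shape_removeBullets, ← hT₁]
    constructor
    · rintro ⟨k, hk⟩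
      have h1 := (hsh r c).1 (mem_shape_of_num hk)
      refine ⟨?_, h1.2⟩
      simp only [ht']
      split_ifs with hb
      · rcases h1.1.eq_or_lt with e | e
        · rw [e, hk] at hb; cases hb
        · exact e
      · exact h1.1
    · rintro ⟨h1, h2⟩
      have h3 : t c ≤ t' c := by simp only [ht']; split_ifs <;> omega
      refine (bullet_or_num ((hsh r c).2 ⟨h3.trans h1, h2⟩)).resolve_left fun hb => ?_
      obtain rfl := htop r c hb
      simp only [ht', if_pos hb] at h1
      omega
  have hlt' : ∀ p ∈ shape (slide m T {(h j, j)}), p.2 < C :=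
    hstep.shape_lt fun p hp => hT.lt_of_mem hp
  have hS' : (prodFrom (col (slide m T {(h j, j)})) S 0 C).Nonempty := by
    rw [hstep.antiRectStep.prodFrom_eq fun p k hp => hlt' p (mem_shape_of_num hp)]
    exact hS
  -- The product is contained in the first column, so this column still has a number.
  have hzero : t' 0 < h' 0 := by
    obtain ⟨k, hk⟩ := hS'
    have hk' := prodFrom_subset _ _ _ _ (by omega) hk
    have hfin : (shape (slide m T {(h j, j)})).Finite := by
      refine hd.skew.finite.subset fun p hp => ?_
      obtain ⟨k, hk⟩ := mem_shape_removeBullets.1 hp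
      exact mem_shape_of_num hk
    rw [mem_col hfin] at hk'
    obtain ⟨r, hr⟩ := hk'
    have := (hmem r 0).1 (mem_shape_of_num hr)
    omega
  refine ⟨_, t', hstep, ⟨hstep.antiRectStep.isIncreasingFilling, hmem, hanti,
    hT.antitone_update hjR hlt, ?_, ?_, ?_, ?_⟩, hS'⟩
  · intro c
    by_cases e : c = j
    · subst e; omega
    · rw [hlen' c e]; exact hT.len_le c
  · intro c hc
    rw [hlen' c (by omega)]
    exact hT.len_eq_zero c hc
  · intro c hc
    rcases lt_trichotomy c j with e | e | e
    -- Columns left of `j` reach the bottom and their tops are no lower than that of column `0`,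
    -- which is nonempty.
    · have h1 := hanti (Nat.zero_le c)
      rw [hlen c e]
      rw [hlen 0 (by omega)] at hzero
      omega
    · subst e
      have h1 := htle c
      have h2 := hT.top_lt_len c hc
      omega
    · rw [htr c e, hlen' c (by omega)]
      exact hT.top_lt_len c hc
  · intro c hc
    have hjc : j ≤ c := by
      by_contra hcon
      have := hlen c (by omega)
      omega
    rw [htr (c + 1) (by omega)]
    refine hT.top_eq_zero c ?_
    have := hT.antitone_len hjc
    omega

/-- Induction on the number of positions missing between the columns and the bottom of the
rectangle; each round fills one. -/
theorem IsPartialAntiRect.exists_isAntiNormal {S : Finset ℕ} : ∀ (n : ℕ) (T : Filling) (t h : ℕ → ℕ),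
    IsPartialAntiRect R C T t h → (prodFrom (col T) S 0 C).Nonempty →
    ∑ c ∈ Finset.range C, (R - h c) = n →
    ∃ Q, Relation.ReflTransGen (LeftmostStep R C) T Q ∧ IsAntiNormal Q := by
  intro n
  induction n with
  | zero =>
    intro T t h hT _ hn
    refine ⟨T, .refl, hT.isAntiNormal fun c hc => ?_⟩
    have h1 := Finset.sum_eq_zero_iff.1 hn c (Finset.mem_range.2 hc)
    have h2 := hT.len_le c
    omega
  | succ n ih =>
    intro T t h hT hS hn
    have hex : ∃ c, c < C ∧ h c < R := by
      by_contra hcon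
      push Not at hcon
      rw [Finset.sum_eq_zero fun c hc => Nat.sub_eq_zero_of_le (hcon c (Finset.mem_range.1 hc))] at hn
      omega
    classical
    obtain ⟨hj, hjR⟩ := Nat.find_spec hex
    have hmin : ∀ c, c < Nat.find hex → h c = R := fun c hc => by
      have h1 := Nat.find_min hex hc
      have h2 := hT.len_le c
      by_contra hne
      exact h1 ⟨by omega, by omega⟩
    generalize Nat.find hex = j at hj hjR hmin
    obtain ⟨T', t', hstep, hT', hS'⟩ := hT.exists_step hS hj hjR hmin
    have hsum : ∑ c ∈ Finset.range C, (R - Function.update h j (h j + 1) c) = n := by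
      rw [← Finset.add_sum_erase _ _ (Finset.mem_range.2 hj)] at hn ⊢
      have : ∀ c ∈ (Finset.range C).erase j, R - Function.update h j (h j + 1) c = R - h c :=
        fun c hc => by rw [Function.update_of_ne (Finset.ne_of_mem_erase hc)]
      rw [Function.update_self, Finset.sum_congr rfl this]
      omega
    obtain ⟨Q, hQ, hQ'⟩ := ih T' t' _ hT' hS' hsum
    exact ⟨Q, .head hstep hQ, hQ'⟩

end Partial

/-! ### Tableaux of normal shape -/

theorem IsIncreasingTableau.isIncreasingFilling {lam : YoungDiagram} {P : Filling}
    (hP : IsIncreasingTableau lam P) : IsIncreasingFilling P :=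
  ⟨hP.no_bullet, hP.pos, hP.row, hP.col⟩

theorem firstCols_eq_num {i : ℕ} {P : Filling} {p : ℕ × ℕ} {k : ℕ}
    (h : firstCols i P p = Cell.num k) : P p = Cell.num k := by
  rw [firstCols] at h
  split_ifs at h
  exact h

theorem IsIncreasingFilling.firstCols {P : Filling} (hP : IsIncreasingFilling P) (i : ℕ) :
    IsIncreasingFilling (firstCols i P) where
  no_bullet p := by
    rw [IncTab.firstCols]
    split_ifs
    · exact hP.no_bullet p
    · simp
  pos p k hp := hP.pos p k (firstCols_eq_num hp)
  row r c c' a b hc ha hb := hP.row r c c' a b hc (firstCols_eq_num ha) (firstCols_eq_num hb)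
  col r r' c a b hr ha hb := hP.col r r' c a b hr (firstCols_eq_num ha) (firstCols_eq_num hb)

theorem colProd_firstCols (i : ℕ) (P : Filling) : colProd (firstCols i P) i = colProd P i := by
  rw [colProd, colProd]
  congr 1
  refine List.map_congr_left fun c hc => col_congr fun r k => ?_
  rw [firstCols, if_pos (List.mem_range.1 hc)]

theorem IsIncreasingTableau.isPartialAntiRect_firstCols {lam : YoungDiagram} {P : Filling}
    (hP : IsIncreasingTableau lam P) {i : ℕ} (hi : i ≤ lam.rowLen 0) :
    IsPartialAntiRect (lam.colLen 0) i (firstCols i P) (fun _ => 0)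
      (fun c => if c < i then lam.colLen c else 0) where
  increasing := hP.isIncreasingFilling.firstCols i
  mem_shape r c := by
    have : (r, c) ∈ shape P ↔ r < lam.colLen c := by
      rw [hP.shape_eq]
      exact YoungDiagram.mem_iff_lt_colLen
    split_ifs with h
    · simpa [shape, firstCols, h] using this
    · simp [shape, firstCols, h]
  antitone_top := antitone_const
  antitone_len c c' hc := by
    have := lam.colLen_anti c c' hc
    dsimp only
    split_ifs <;> omega
  len_le c := by
    have := lam.colLen_anti 0 c (Nat.zero_le c)
    split_ifs <;> omega
  len_eq_zero c hc := if_neg (by omega)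
  top_lt_len c hc := by
    rw [if_pos hc, ← YoungDiagram.mem_iff_lt_colLen, YoungDiagram.mem_iff_lt_rowLen]
    omega
  top_eq_zero _ _ := rfl

/-- The product of the columns of a filling of normal shape is nonempty. -/
theorem IsPartialAntiRect.prodFrom_nonempty {R C N : ℕ} {T : Filling} {h : ℕ → ℕ}
    (hT : IsPartialAntiRect R C T (fun _ => 0) h) (hN : ∀ x ∈ col T (C - 1), x < N) :
    ∀ n a, a + (n + 1) = C → (prodFrom (col T) (Finset.Ico N (2 * N)) a (n + 1)).Nonempty := by
  have hf := hT.finite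
  intro n
  induction n with
  | zero =>
    intro a ha
    obtain rfl : a = C - 1 := by omega
    rw [prodFrom, prodFrom, tri_Ico_eq_left hN]
    obtain ⟨k, hk⟩ := hT.increasing.exists_num
      ((hT.mem_shape 0 (C - 1)).2 ⟨le_rfl, hT.top_lt_len _ (by omega)⟩)
    exact ⟨k, (mem_col hf).2 ⟨0, hk⟩⟩
  | succ n ih =>
    intro a ha
    obtain ⟨u, hu⟩ := ih (a + 1) (by omega)
    have hu' := prodFrom_subset _ _ _ _ (by omega) hu
    rw [mem_col hf] at hu'
    obtain ⟨r, hr⟩ := hu'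
    have h1 := (hT.mem_shape r (a + 1)).1 (mem_shape_of_num hr)
    have h2 := hT.antitone_len (Nat.le_succ a)
    obtain ⟨k, hk⟩ := hT.increasing.exists_num ((hT.mem_shape r a).2 ⟨Nat.zero_le _, by
      exact h1.2.trans_le h2⟩)
    rw [prodFrom]
    exact tri_nonempty hu ((mem_col hf).2 ⟨r, hk⟩)
      (hT.increasing.row r a (a + 1) k u (by omega) hk hr)

/-- Numbers never retreat from the last of the `i` columns, and the rectangle forbids going beyond
it, so part (1) applies to the first `i` columns. -/
theorem IsIncreasingTableau.eq_colProd_of_reflTransGen {lam : YoungDiagram} {P Q : Filling}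
    (hP : IsIncreasingTableau lam P) {i : ℕ} (hi₀ : 1 ≤ i) (hi : i ≤ lam.rowLen 0)
    (h : Relation.ReflTransGen (LeftmostStep (lam.colLen 0) i) (firstCols i P) Q)
    (hQ : IsAntiNormal Q) : IncTab.col Q 0 = colProd P i := by
  have hT := hP.isPartialAntiRect_firstCols hi
  obtain ⟨k, hk⟩ := hT.increasing.exists_num
    ((hT.mem_shape 0 (i - 1)).2 ⟨le_rfl, hT.top_lt_len _ (by omega)⟩)
  have hC : HasRightmostColumn Q i := hasRightmostColumn_of_reflTransGen h
    (fun p hp => hT.lt_of_mem hp) ⟨_, k, by simp; omega, hk⟩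
  have hrect : IsAntiRectification (firstCols i P) Q :=
    ⟨Relation.ReflTransGen.mono (fun _ _ hs => hs.antiRectStep) _ _ h, hQ⟩
  rw [hrect.col_zero_eq hT.increasing hC, colProd_firstCols]

theorem IsIncreasingTableau.isLeftKeyColumn_iff {lam : YoungDiagram} {P : Filling}
    (hP : IsIncreasingTableau lam P) {i : ℕ} (hi₀ : 1 ≤ i) (hi : i ≤ lam.rowLen 0) (K : Finset ℕ) :
    IsLeftKeyColumn (lam.colLen 0) P i K ↔ K = colProd P i := by
  constructor
  · rintro ⟨Q, h, hQ, rfl⟩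
    exact hP.eq_colProd_of_reflTransGen hi₀ hi h hQ
  · rintro rfl
    have hT := hP.isPartialAntiRect_firstCols hi
    obtain ⟨N, hN⟩ := exists_forall_lt (IncTab.col (firstCols i P) (i - 1))
    obtain ⟨n, rfl⟩ : ∃ n, i = n + 1 := ⟨i - 1, by omega⟩
    obtain ⟨Q, h, hQ⟩ := IsPartialAntiRect.exists_isAntiNormal _ _ _ _ hT
      (hT.prodFrom_nonempty hN n 0 (by omega)) rfl
    exact ⟨Q, h, hQ, (hP.eq_colProd_of_reflTransGen hi₀ hi h hQ).symm⟩

end IncTab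

theorem theorem5p9 (lam : YoungDiagram) (P : IncTab.Filling)
    (hP : IncTab.IsIncreasingTableau lam P) :
    (∀ Q : IncTab.Filling, IncTab.IsAntiRectification P Q →
      IncTab.HasRightmostColumn Q (lam.rowLen 0) →
      IncTab.col Q 0 = IncTab.colProd P (lam.rowLen 0)) ∧
    (∀ i : ℕ, 1 ≤ i → i ≤ lam.rowLen 0 → ∀ K : Finset ℕ,
      IncTab.IsLeftKeyColumn (lam.colLen 0) P i K ↔ K = IncTab.colProd P i) :=
  ⟨fun _ hQ hC => hQ.col_zero_eq hP.isIncreasingFilling hC,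
    fun _ hi₀ hi K => hP.isLeftKeyColumn_iff hi₀ hi K⟩
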